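/- **Setting.** Let $\mathcal D$ be a probability distribution, $f(x,\xi)$ a sampling function for $x\in\mathbb R^d$, $\xi\sim\mathcal D$, and $F(x)=\mathbb E_{\xi\sim\mathcal D}[f(x,\xi)]$. Write $\|\cdot\|$ for the Euclidean norm and $\nabla f(x,\xi)$ for the gradient in $x$. Let $\sigma,\beta,\hat\sigma\ge 0$ and assume: (1) $F^*:=\inf_{x}F(x)>-\infty$; (2) $\mathbb E_\xi[\nabla f(x,\xi)]=\nabla F(x)$ and $\mathbb E_\xi\|\nabla f(x,\xi)-\nabla F(x)\|^2\le\sigma^2$ for all $x$; (3) $\mathbb E_\xi\|\nabla f(x,\xi)-\nabla f(y,\xi)\|^2\le\beta^2\|x-y\|^2$ for all $x,y$; (5) $\|\nabla f(x,\xi)-\nabla f(x,\xi')\|\le 2\hat\sigma$ for all $x$ and all $\xi,\xi'$ in the support of $\mathcal D$. **Algorithm (META-STORM with $p=\tfrac12$, $q=\tfrac14$, $a_0=b_0=\eta=1$).** Given $x_1\in\mathbb R^d$, $T\ge 1$ and i.i.d. samples $\xi_1,\xi_2,\dots\sim\mathcal D$, put $d_1=\nabla f(x_1,\xi_1)$,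 $a_1=1$ and, for $t=1,\dots,T$, $$b_t=\Big(1+\sum_{i=1}^t\|d_i\|^2\Big)^{1/2}\Big/a_t^{1/4},\qquad x_{t+1}=x_t-\frac{1}{b_t}d_t,$$ $$a_{t+1}=\Big(1+\sum_{i=1}^t\|\nabla f(x_i,\xi_i)-\nabla f(x_i,\xi_{i+1})\|^2\Big)^{-2/3},$$ $$d_{t+1}=\nabla f(x_{t+1},\xi_{t+1})+(1-a_{t+1})\big(d_t-\nabla f(x_t,\xi_{t+1})\big).$$ The output is $x_{\mathrm{out}}=x_t$ with $t$ uniform on $\{1,\dots,T\}$, independent of the samples. **Statement.** There is an absolute constant $C>0$ such that in this setting, for every $0<\delta<1$, with probability at least $1-\delta$, $$\|\nabla F(x_{\mathrm{out}})\|\le C\,\frac{\kappa_1+\kappa_2\log(1+\sigma^2T)}{\delta^{7/6}}\Big(\frac1{T^{1/2}}+\frac{\sigma^{1/3}}{T^{1/3}}\Big),$$ where $\kappa_2=(1+\hat\sigma^3)\max\{\beta,1\}$ and $\kappa_1=1+F(x_1)-F^*+\hat\sigma\sigma+\sigma^2+\hat\sigma^3+\kappa_2\log\kappa_2$. -/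

import Mathlib

open MeasureTheory ProbabilityTheory

namespace MetaStorm

/-- The objective `F(x) = 𝔼_{ξ ∼ 𝒟}[f(x, ξ)]`. -/
noncomputable def objective {d : ℕ} {Ξ : Type*} [MeasurableSpace Ξ] (𝒟 : Measure Ξ)
    (f : EuclideanSpace ℝ (Fin d) → Ξ → ℝ) (x : EuclideanSpace ℝ (Fin d)) : ℝ :=
  ∫ ξ, f x ξ ∂𝒟

/-- The stochastic gradient `∇f(x, ξ)`, the gradient being taken in `x`. -/
noncomputable def sampleGrad {d : ℕ} {Ξ : Type*} (f : EuclideanSpace ℝ (Fin d) → Ξ → ℝ)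
    (x : EuclideanSpace ℝ (Fin d)) (ξ : Ξ) : EuclideanSpace ℝ (Fin d) :=
  gradient (fun y => f y ξ) x

/-- The standing assumptions on the stochastic optimization problem `min F`: well-posedness
(integrability, differentiability, measurability), lower bounded function value, unbiased
gradient estimator with variance at most `σ²`, averaged `β`-smoothness, and stochastic gradient
differences bounded by `2 σh`.  Since `Ξ` carries no topology, "for `ξ, ξ'` in the support of `𝒟`"
is expressed by "for `𝒟`-almost all `ξ, ξ'`". -/
structure Assumptions {d : ℕ} {Ξ : Type*} [MeasurableSpace Ξ] (𝒟 : Measure Ξ)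
    (f : EuclideanSpace ℝ (Fin d) → Ξ → ℝ) (σ β σh : ℝ) : Prop where
  sigma_nonneg : 0 ≤ σ
  beta_nonneg : 0 ≤ β
  sigmaHat_nonneg : 0 ≤ σh
  integrable : ∀ x, Integrable (f x) 𝒟
  differentiableAt_sample : ∀ x, ∀ᵐ ξ ∂𝒟, DifferentiableAt ℝ (fun y => f y ξ) x
  differentiable_objective : Differentiable ℝ (objective 𝒟 f)
  measurable_grad :
    Measurable (fun z : EuclideanSpace ℝ (Fin d) × Ξ => sampleGrad f z.1 z.2)
  lower_bounded : BddBelow (Set.range (objective 𝒟 f))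
  integrable_grad : ∀ x, Integrable (sampleGrad f x) 𝒟
  unbiased : ∀ x, ∫ ξ, sampleGrad f x ξ ∂𝒟 = gradient (objective 𝒟 f) x
  integrable_variance : ∀ x,
    Integrable (fun ξ => ‖sampleGrad f x ξ - gradient (objective 𝒟 f) x‖ ^ 2) 𝒟
  variance_le : ∀ x,
    ∫ ξ, ‖sampleGrad f x ξ - gradient (objective 𝒟 f) x‖ ^ 2 ∂𝒟 ≤ σ ^ 2
  integrable_smooth : ∀ x y,
    Integrable (fun ξ => ‖sampleGrad f x ξ - sampleGrad f y ξ‖ ^ 2) 𝒟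
  smooth : ∀ x y,
    ∫ ξ, ‖sampleGrad f x ξ - sampleGrad f y ξ‖ ^ 2 ∂𝒟 ≤ β ^ 2 * ‖x - y‖ ^ 2
  bounded_diff : ∀ x, ∀ᵐ ξ ∂𝒟, ∀ᵐ ξ' ∂𝒟, ‖sampleGrad f x ξ - sampleGrad f x ξ'‖ ≤ 2 * σh

/-- The parameters `a₀, b₀, η, p, q` of the algorithm. -/
structure Params where
  a₀ : ℝ
  b₀ : ℝ
  η : ℝ
  p : ℝ
  q : ℝ

/-- The state of the algorithm at iteration `t`: the point `x_t`, the momentum `d_t` and the two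
running sums that determine `a_t` and `b_t`. -/
structure State (d : ℕ) where
  /-- the point `x_t` -/
  x : EuclideanSpace ℝ (Fin d)
  /-- the momentum `d_t` -/
  mom : EuclideanSpace ℝ (Fin d)
  /-- `∑_{i < t} ‖∇f(x_i, ξ_i) - ∇f(x_i, ξ_{i+1})‖²` -/
  diffSum : ℝ
  /-- `∑_{i ≤ t} ‖d_i‖²` -/
  momSum : ℝ

/-- `a = (1 + S / a₀²)^{-2/3}`, where `S` is the sum of the squared gradient differences. -/
noncomputable def momentumCoeff (P : Params) (S : ℝ) : ℝ :=
  (1 + S / P.a₀ ^ 2) ^ (-(2 / 3) : ℝ)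

/-- `b_t = (b₀^{1/p} + ∑_{i ≤ t} ‖d_i‖²)^p / a_t^q`. -/
noncomputable def stepCoeff {d : ℕ} (P : Params) (s : State d) : ℝ :=
  (P.b₀ ^ (1 / P.p) + s.momSum) ^ P.p / (momentumCoeff P s.diffSum) ^ P.q

/-- The state at the first iteration, from the initial point and the first sample. -/
noncomputable def init {d : ℕ} {Ξ : Type*} (f : EuclideanSpace ℝ (Fin d) → Ξ → ℝ)
    (x₁ : EuclideanSpace ℝ (Fin d)) (ξ₁ : Ξ) : State d where
  x := x₁
  mom := sampleGrad f x₁ ξ₁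
  diffSum := 0
  momSum := ‖sampleGrad f x₁ ξ₁‖ ^ 2

/-- One iteration: from the state at iteration `t`, the sample `ξ = ξ_t` used last and the fresh
sample `ξ' = ξ_{t+1}` to the state at iteration `t + 1`. -/
noncomputable def step {d : ℕ} {Ξ : Type*} (f : EuclideanSpace ℝ (Fin d) → Ξ → ℝ) (P : Params)
    (s : State d) (ξ ξ' : Ξ) : State d :=
  let x' := s.x - (P.η / stepCoeff P s) • s.mom
  let S' := s.diffSum + ‖sampleGrad f s.x ξ - sampleGrad f s.x ξ'‖ ^ 2
  let d' := sampleGrad f x' ξ' + (1 - momentumCoeff P S') • (s.mom - sampleGrad f s.x ξ')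
  { x := x', mom := d', diffSum := S', momSum := s.momSum + ‖d'‖ ^ 2 }

/-- The run of META-STORM started at `x₁` on the sample sequence `ξ`.  Iterations and samples are
numbered from `0`: `run f P x₁ ξ k` is the state at the `(k + 1)`-st iteration, and `ξ k` is the
`(k + 1)`-st sample. -/
noncomputable def run {d : ℕ} {Ξ : Type*} (f : EuclideanSpace ℝ (Fin d) → Ξ → ℝ) (P : Params)
    (x₁ : EuclideanSpace ℝ (Fin d)) (ξ : ℕ → Ξ) : ℕ → State d
  | 0 => init f x₁ (ξ 0)
  | k + 1 => step f P (run f P x₁ ξ k) (ξ k) (ξ (k + 1))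

/-- The choice `a₀ = b₀ = η = 1`, `p = 1/2`, hence `q = 1/4` (as `p + 2q = 1`). -/
noncomputable def stdParams : Params where
  a₀ := 1
  b₀ := 1
  η := 1
  p := 1 / 2
  q := 1 / 4

/-- The randomness of a run with `T` iterations: the samples `ξ k` are i.i.d. with law `𝒟`, and the
output index `τ` is uniform on the `T` indices `0, …, T - 1` and independent of the samples. -/
structure IsRandomness {Ξ Ω : Type*} [MeasurableSpace Ξ] [MeasurableSpace Ω] (𝒟 : Measure Ξ)
    (P : Measure Ω) (T : ℕ) (ξ : ℕ → Ω → Ξ) (τ : Ω → ℕ) : Prop where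
  measurable_sample : ∀ k, Measurable (ξ k)
  law_sample : ∀ k, P.map (ξ k) = 𝒟
  indep_sample : iIndepFun ξ P
  measurable_index : Measurable τ
  law_index : P.map τ = uniformOn (Set.Iio T)
  indep_index : IndepFun τ (fun ω k => ξ k ω) P

/-- The output `x_out = x_τ`. -/
noncomputable def output {d : ℕ} {Ξ Ω : Type*} (f : EuclideanSpace ℝ (Fin d) → Ξ → ℝ)
    (P : Params) (x₁ : EuclideanSpace ℝ (Fin d)) (ξ : ℕ → Ω → Ξ) (τ : Ω → ℕ) (ω : Ω) :
    EuclideanSpace ℝ (Fin d) :=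
  (run f P x₁ (fun k => ξ k ω) (τ ω)).x

/-- `κ₂ = (1 + σh³) max{β, 1}`. -/
noncomputable def kappa₂ (β σh : ℝ) : ℝ := (1 + σh ^ 3) * max β 1

/-- `κ₁ = 1 + Δ + σh σ + σ² + σh³ + κ₂ log κ₂`, where `Δ = F(x₁) - F^*`. -/
noncomputable def kappa₁ (Δ σ β σh : ℝ) : ℝ :=
  1 + Δ + σh * σ + σ ^ 2 + σh ^ 3 + kappa₂ β σh * Real.log (kappa₂ β σh)

end MetaStorm

/-! Write `u_k = a_k^{-1/2}` (`pathU`) and `D_k = 1 + ∑_{i ≤ k} ‖d_i‖²` (`pathD`), so that the step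
is `d_k / √(D_k u_k)`. Let `ε_k = d_k - ∇F(x_k)` (`pathErr`), `W = ∑ ‖ε_k‖² / u_k` (`pathW`) and `Y
= √(D_n / u_n)`. Two inequalities couple `Y` and `W`.

Descent of `F`, summed along a path, bounds `Y` by the initial gap, `W` and `log D_n`
(`Assumptions.sqrt_pathD_div_le`).

The error obeys `ε_{k+1} = (1 - a)(ε_k + Z) + a N` with `a = a_{k+1}`, `Z` the centred gradient
difference and `N` the noise at `x_{k+1}`. The obstacle is that `a_{k+1}` depends on the sample
driving `Z` and `N`, so the cross terms are not centred. `weighted_error_step` replaces `a_{k+1}` by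
`a_k` there and pays for the change out of the contraction. This works for the weight `u_k + 8B`,
where `B = 16 σ̂²` bounds the growth of `u³` in one step. In expectation (`integral_pathW_le`) the
cross terms vanish. The sum of `u ‖Z‖²` is at most `4β² log D_n`, because `‖x_{k+1} - x_k‖² = ‖d_k‖²
/ (D_k u_k)`. The sum of the weighted `‖N‖²` is compared by Jensen with the same sum for the sampled
gradient differences, which is logarithmic since their squares are the increments of `u³`.

As `log D_n = 2 log Y + log u_n`, the logarithm can be absorbed into `Y`; `coupled_bounds` solves
the system, and `integral_sqrt_add_sqrt_le` bounds `𝔼[Y + √W]`.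

Finally `∑ ‖∇F(x_k)‖² ≤ 2 u_n (Y + √W)²`, but only `𝔼 u_n³` and `𝔼[Y + √W]` are controlled, not the
expectation of this product. The proportion `c` of indices with gradient above a threshold lies in
`[0, 1]`, so `c ≤ c^{3/7}`, and a weighted mean inequality makes the bound linear in `u_n³` and `Y +
√W` (`le_mul_mean_of_le`). This produces the power `δ^{7/6}`. -/

namespace MetaStorm

/-! ### One step of the momentum error recursion. -/

section Recursion

/-- Cube growth `u'³ ≤ u³ + B` with `u ≥ 1` bounds the growth of the square. -/
lemma sq_le_sq_add_of_cube_le {u v B : ℝ} (hu : 1 ≤ u) (huv : u ≤ v) (hB : 0 ≤ B)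
    (h : v ^ 3 ≤ u ^ 3 + B) : v ^ 2 ≤ u ^ 2 + B := by
  by_contra! hc
  have h1 : u * v ^ 2 ≤ v * v ^ 2 := mul_le_mul_of_nonneg_right huv (sq_nonneg v)
  have h2 : u * (u ^ 2 + B) < u * v ^ 2 := mul_lt_mul_of_pos_left hc (by linarith)
  nlinarith [mul_nonneg hB (sub_nonneg.2 hu)]

/-- Factor `v³ - u³ = (v - u)(v² + uv + u²)` and keep only `v²`. As `v⁻²` is the new momentum
coefficient, the weight grows by at most `B` times the contraction rate. -/
lemma sub_le_div_sq_of_cube_le {u v B : ℝ} (hu : 1 ≤ u) (huv : u ≤ v)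
    (h : v ^ 3 ≤ u ^ 3 + B) : v - u ≤ B / v ^ 2 := by
  have hv : 0 < v := by linarith
  rw [le_div_iff₀ (by positivity)]
  nlinarith [mul_nonneg (mul_nonneg (sub_nonneg.2 huv) (by linarith : 0 ≤ u)) (by linarith : 0 ≤ u + v)]

/-- Young's inequality in the form used for the cross terms: the coefficient `c` is split as
`c² ≤ P Q`. -/
lemma cross_le_of_sq_le {c P Q e z i : ℝ} (hP : 0 ≤ P) (hQ : 0 ≤ Q) (hc : c ^ 2 ≤ P * Q)
    (hi : |i| ≤ e * z) (he : 0 ≤ e) (hz : 0 ≤ z) : 2 * c * i ≤ P * e ^ 2 + Q * z ^ 2 := by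
  have h1 : c * i ≤ |c| * (e * z) := by
    calc c * i ≤ |c * i| := le_abs_self _
      _ = |c| * |i| := abs_mul _ _
      _ ≤ _ := by gcongr
  have h2 : |c| ≤ √P * √Q := by
    rw [← Real.sqrt_mul hP, ← Real.sqrt_sq_eq_abs]
    exact Real.sqrt_le_sqrt hc
  have h3 : |c| * (e * z) ≤ (√P * √Q) * (e * z) := by gcongr
  nlinarith [sq_nonneg (√P * e - √Q * z), Real.sq_sqrt hP, Real.sq_sqrt hQ]

set_option maxHeartbeats 1000000 in
/-- One step of the weighted error recursion, with the norms and inner products of the error, the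
smoothness noise and the variance noise as real variables. -/
lemma weighted_error_step_real {u v B e z n i j : ℝ} (hu : 1 ≤ u) (huv : u ≤ v) (hB : 0 ≤ B)
    (h : v ^ 3 ≤ u ^ 3 + B) (he : 0 ≤ e) (hz : 0 ≤ z) (hn : 0 ≤ n)
    (hi : |i| ≤ e * z) (hj : |j| ≤ e * n) :
    (v + 8 * B) * ((1 - (v ^ 2)⁻¹) ^ 2 * e ^ 2 + 2 * (1 - (v ^ 2)⁻¹) ^ 2 * i
        + 2 * ((v ^ 2)⁻¹ * (1 - (v ^ 2)⁻¹)) * j + (2 * z ^ 2 + 2 * ((v ^ 2)⁻¹) ^ 2 * n ^ 2))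
      + 3 / 8 * (e ^ 2 / u)
    ≤ (u + 8 * B) * e ^ 2
      + (2 * ((u + 8 * B) * (1 - (u ^ 2)⁻¹) ^ 2) * i
        + 2 * ((u + 8 * B) * ((u ^ 2)⁻¹ * (1 - (u ^ 2)⁻¹))) * j)
      + 300 * (1 + B) ^ 2 * (u * z ^ 2) + 2 * ((v + 8 * B) * ((v ^ 2)⁻¹) ^ 2 * n ^ 2)
      + 129 * (1 + B) ^ 2 * ((u⁻¹ - v⁻¹) * n ^ 2) := by
  have hv : 1 ≤ v := hu.trans huv
  have hu0 : 0 < u := by linarith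
  have hv0 : 0 < v := by linarith
  have hsq := sq_le_sq_add_of_cube_le hu huv hB h
  have hΔ := sub_le_div_sq_of_cube_le hu huv h
  obtain ⟨a, ha⟩ : ∃ a, a = (u ^ 2)⁻¹ := ⟨_, rfl⟩
  obtain ⟨r, hr⟩ : ∃ r, r = (v ^ 2)⁻¹ := ⟨_, rfl⟩
  rw [← ha, ← hr]
  have hr0 : 0 < r := by rw [hr]; positivity
  have ha0 : 0 < a := by rw [ha]; positivity
  have ha1 : a ≤ 1 := by rw [ha]; exact inv_le_one_of_one_le₀ (one_le_pow₀ ‹_›)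
  have hra : r ≤ a := by rw [hr, ha]; gcongr
  have hr1 : r ≤ 1 := hra.trans ha1
  have hr1' : (1 - r) ^ 2 ≤ 1 := pow_le_one₀ (by linarith) (by linarith)
  have hrv : r * v ^ 2 = 1 := by rw [hr]; field_simp
  have hau : a * u ^ 2 = 1 := by rw [ha]; field_simp
  have hδ : v - u ≤ B * r := by rw [hr, ← div_eq_mul_inv]; exact hΔ
  have hδ0 : 0 ≤ v - u := by linarith
  have hw0 : 0 < u + 8 * B := by linarith
  have hw0' : 0 < v + 8 * B := by linarith
  -- `P = r w'` is the contraction gained in one step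
  obtain ⟨P, hP⟩ : ∃ P, P = r * (v + 8 * B) := ⟨_, rfl⟩
  have hP0 : 0 < P := by rw [hP]; positivity
  -- The contraction dominates the summand of `pathW`.
  have hPu : e ^ 2 / u ≤ P * e ^ 2 := by
    have h1 : 1 / u ≤ P := by
      rw [div_le_iff₀ hu0, hP]
      have : v ^ 2 ≤ (v + 8 * B) * u := by
        linarith [mul_nonneg hB (sub_nonneg.2 hu), mul_nonneg hu0.le hδ0]
      calc 1 = r * v ^ 2 := hrv.symm
        _ ≤ r * ((v + 8 * B) * u) := by gcongr
        _ = _ := by ring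
    calc e ^ 2 / u = (1 / u) * e ^ 2 := by ring
      _ ≤ _ := by gcongr
  -- This fixes the constant `8` in the weight: `P = r v + 8 B r`, so an eighth of `P` covers the
  -- growth `B r` of the weight.
  have hδP : v - u ≤ P / 8 := by
    have : B * r ≤ P / 8 := by rw [hP]; linarith [mul_pos hr0 hv0]
    linarith
  have hPr : P ≤ v + 8 * B := by rw [hP]; exact mul_le_of_le_one_left hw0'.le hr1
  have hwr : u + 8 * B ≤ P / r := by
    rw [le_div_iff₀ hr0, hP]; linarith [mul_nonneg hr0.le hδ0]
  have hratio : a - r ≤ B * r := by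
    have h1 : a - r = a * r * (v ^ 2 - u ^ 2) := by
      have : a * r * (v ^ 2 - u ^ 2) = a * (r * v ^ 2) - r * (a * u ^ 2) := by ring
      rw [this, hrv, hau]; ring
    rw [h1]
    calc a * r * (v ^ 2 - u ^ 2) ≤ a * r * B := by gcongr; linarith
      _ ≤ 1 * r * B := by gcongr
      _ = _ := by ring
  have hwu : u + 8 * B ≤ (1 + 8 * B) * u := by linarith [mul_nonneg hB (sub_nonneg.2 hu)]
  have hwv : v + 8 * B ≤ (1 + 9 * B) * u := by
    have : B * r ≤ B := mul_le_of_le_one_right hB hr1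
    linarith [mul_nonneg hB (sub_nonneg.2 hu)]
  have har0 : 0 ≤ a - r := by linarith
  -- `w (a - r)² ≤ B w (a - r) r`
  have hsqr : (u + 8 * B) * (a - r) ≤ B * P := by
    calc (u + 8 * B) * (a - r) ≤ (u + 8 * B) * (B * r) := by gcongr
      _ ≤ P / r * (B * r) := by gcongr
      _ = B * P := by field_simp
  -- The drift of the momentum coefficient is turned into a telescoping difference, so its total
  -- effect stays bounded.
  have htel : u * (a - r) ≤ 2 * (u⁻¹ - v⁻¹) := by
    have h1 : a - r = (u⁻¹ - v⁻¹) * (u⁻¹ + v⁻¹) := by rw [ha, hr]; field_simp; ring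
    have h2 : 0 ≤ u⁻¹ - v⁻¹ := sub_nonneg.2 (by gcongr)
    have h3 : u * (u⁻¹ + v⁻¹) ≤ 2 := by
      have : u * v⁻¹ ≤ 1 := by rw [← div_eq_mul_inv]; exact (div_le_one hv0).2 huv
      rw [mul_add, mul_inv_cancel₀ hu0.ne']; linarith
    calc u * (a - r) = (u⁻¹ - v⁻¹) * (u * (u⁻¹ + v⁻¹)) := by rw [h1]; ring
      _ ≤ (u⁻¹ - v⁻¹) * 2 := by gcongr
      _ = _ := by ring
  have htel' : (v - u) * r ^ 2 ≤ u⁻¹ - v⁻¹ := by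
    have h1 : u⁻¹ - v⁻¹ = (v - u) * (u * v)⁻¹ := by field_simp
    rw [h1]
    refine mul_le_mul_of_nonneg_left ?_ hδ0
    rw [hr, inv_pow]
    gcongr
    calc u * v ≤ v * v := by gcongr
      _ = v ^ 2 * 1 := by ring
      _ ≤ v ^ 2 * v ^ 2 := by gcongr; exact one_le_pow₀ hv
      _ = (v ^ 2) ^ 2 := by ring
  -- the four cross terms
  have c1 : 2 * ((v - u) * (1 - r) ^ 2) * i ≤ P / 8 * e ^ 2 + P / 8 * z ^ 2 := by
    refine cross_le_of_sq_le (by positivity) (by positivity) ?_ hi he hz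
    rw [← sq]
    have h1 : (v - u) * (1 - r) ^ 2 ≤ P / 8 := (mul_le_of_le_one_right hδ0 hr1').trans hδP
    have h2 : 0 ≤ (v - u) * (1 - r) ^ 2 := by positivity
    exact pow_le_pow_left₀ h2 h1 2
  have c2 : 2 * ((u + 8 * B) * ((1 - r) ^ 2 - (1 - a) ^ 2)) * i
      ≤ P / 8 * e ^ 2 + 32 * ((u + 8 * B) * B) * z ^ 2 := by
    refine cross_le_of_sq_le (by positivity) (by positivity) ?_ hi he hz
    have h0 : (1 - r) ^ 2 - (1 - a) ^ 2 = (a - r) * (2 - a - r) := by ring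
    have h1 : (1 - r) ^ 2 - (1 - a) ^ 2 ≤ 2 * (a - r) := by
      rw [h0, mul_comm]; exact mul_le_mul_of_nonneg_right (by linarith) har0
    have h2 : 0 ≤ (1 - r) ^ 2 - (1 - a) ^ 2 := by
      rw [h0]; exact mul_nonneg har0 (by linarith)
    calc ((u + 8 * B) * ((1 - r) ^ 2 - (1 - a) ^ 2)) ^ 2
        ≤ ((u + 8 * B) * (2 * (a - r))) ^ 2 := by gcongr
      _ = 4 * ((u + 8 * B) * ((u + 8 * B) * (a - r)) * (a - r)) := by ring
      _ ≤ 4 * ((u + 8 * B) * (B * P) * 1) := by gcongr; linarith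
      _ = P / 8 * (32 * ((u + 8 * B) * B)) := by ring
  have c3 : 2 * ((v - u) * (r * (1 - r))) * j
      ≤ P / 8 * e ^ 2 + ((v - u) * r ^ 2) * n ^ 2 := by
    refine cross_le_of_sq_le (by positivity) (by positivity) ?_ hj he hn
    calc ((v - u) * (r * (1 - r))) ^ 2 = (v - u) * ((v - u) * r ^ 2) * (1 - r) ^ 2 := by ring
      _ ≤ (P / 8) * ((v - u) * r ^ 2) * 1 := by gcongr
      _ = _ := by ring
  have c4 : 2 * ((u + 8 * B) * (r * (1 - r) - a * (1 - a))) * j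
      ≤ P / 8 * e ^ 2 + 8 * B * ((u + 8 * B) * (a - r)) * n ^ 2 := by
    refine cross_le_of_sq_le (by positivity) (by positivity) ?_ hj he hn
    have h1 : (r * (1 - r) - a * (1 - a)) ^ 2 ≤ (a - r) ^ 2 := by
      have : (r * (1 - r) - a * (1 - a)) = (a - r) * (a + r - 1) := by ring
      rw [this, mul_pow]
      have : (a + r - 1) ^ 2 ≤ 1 := (sq_le_one_iff_abs_le_one _).2 (abs_le.2 ⟨by linarith, by linarith⟩)
      exact mul_le_of_le_one_right (sq_nonneg _) this
    calc ((u + 8 * B) * (r * (1 - r) - a * (1 - a))) ^ 2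
        = (u + 8 * B) ^ 2 * (r * (1 - r) - a * (1 - a)) ^ 2 := by ring
      _ ≤ (u + 8 * B) ^ 2 * (a - r) ^ 2 := by gcongr
      _ = ((u + 8 * B) * (a - r)) * ((u + 8 * B) * (a - r)) := by ring
      _ ≤ (B * P) * ((u + 8 * B) * (a - r)) := by gcongr
      _ = P / 8 * (8 * B * ((u + 8 * B) * (a - r))) := by ring
  -- Budget for `P`: one eighth pays for the growth of the weight and each of the four cross terms
  -- takes another eighth, which leaves the `3/8` of the conclusion.
  have m1 : (v + 8 * B) * (1 - r) ^ 2 * e ^ 2 ≤ (u + 8 * B) * e ^ 2 - 7 / 8 * P * e ^ 2 := by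
    have : (v + 8 * B) * (1 - r) ^ 2 ≤ (u + 8 * B) - 7 / 8 * P := by
      have h1 : (1 - r) ^ 2 ≤ 1 - r := by
        rw [sq]; exact mul_le_of_le_one_right (by linarith) (by linarith)
      calc (v + 8 * B) * (1 - r) ^ 2 ≤ (v + 8 * B) * (1 - r) := by gcongr
        _ = v + 8 * B - P := by rw [hP]; ring
        _ ≤ _ := by linarith
    have := mul_le_mul_of_nonneg_right this (sq_nonneg e)
    linarith
  have m2 : (2 * (v + 8 * B) + P / 8 + 32 * ((u + 8 * B) * B)) * z ^ 2
      ≤ 300 * (1 + B) ^ 2 * (u * z ^ 2) := by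
    have h1 : (u + 8 * B) * B ≤ (1 + 8 * B) * u * B := by gcongr
    have : 2 * (v + 8 * B) + P / 8 + 32 * ((u + 8 * B) * B) ≤ 300 * (1 + B) ^ 2 * u := by
      linarith [mul_nonneg hB hu0.le, mul_nonneg (mul_nonneg hB hB) hu0.le]
    calc _ ≤ 300 * (1 + B) ^ 2 * u * z ^ 2 := by gcongr
      _ = _ := by ring
  have m3 : ((v - u) * r ^ 2 + 8 * B * ((u + 8 * B) * (a - r))) * n ^ 2
      ≤ 129 * (1 + B) ^ 2 * ((u⁻¹ - v⁻¹) * n ^ 2) := by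
    have h2 : 0 ≤ u⁻¹ - v⁻¹ := sub_nonneg.2 (by gcongr)
    have h1 : (u + 8 * B) * (a - r) ≤ (1 + 8 * B) * (2 * (u⁻¹ - v⁻¹)) := by
      calc (u + 8 * B) * (a - r) ≤ (1 + 8 * B) * u * (a - r) := by gcongr
        _ = (1 + 8 * B) * (u * (a - r)) := by ring
        _ ≤ _ := by gcongr
    have : (v - u) * r ^ 2 + 8 * B * ((u + 8 * B) * (a - r))
        ≤ 129 * (1 + B) ^ 2 * (u⁻¹ - v⁻¹) := by
      calc _ ≤ (u⁻¹ - v⁻¹) + 8 * B * ((1 + 8 * B) * (2 * (u⁻¹ - v⁻¹))) := by gcongr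
        _ = (1 + 16 * B + 128 * B ^ 2) * (u⁻¹ - v⁻¹) := by ring
        _ ≤ _ := by gcongr; linarith [sq_nonneg B]
    calc _ ≤ 129 * (1 + B) ^ 2 * (u⁻¹ - v⁻¹) * n ^ 2 := by gcongr
      _ = _ := by ring
  linarith [c1, c2, c3, c4, m1, m2, m3, hPu]

/-- One step of the weighted error recursion: the error `ε` with weight `u + 8B` is contracted, up
to two terms that are linear in the noise and the squares of the noise. -/
lemma weighted_error_step {E : Type*} [NormedAddCommGroup E] [InnerProductSpace ℝ E]
    {u v B : ℝ} (hu : 1 ≤ u) (huv : u ≤ v) (hB : 0 ≤ B) (h : v ^ 3 ≤ u ^ 3 + B) (ε Z N : E) :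
    (v + 8 * B) * ‖(1 - (v ^ 2)⁻¹) • (ε + Z) + (v ^ 2)⁻¹ • N‖ ^ 2 + 3 / 8 * (‖ε‖ ^ 2 / u)
    ≤ (u + 8 * B) * ‖ε‖ ^ 2
      + (2 * ((u + 8 * B) * (1 - (u ^ 2)⁻¹) ^ 2) * inner ℝ ε Z
        + 2 * ((u + 8 * B) * ((u ^ 2)⁻¹ * (1 - (u ^ 2)⁻¹))) * inner ℝ ε N)
      + 300 * (1 + B) ^ 2 * (u * ‖Z‖ ^ 2) + 2 * ((v + 8 * B) * ((v ^ 2)⁻¹) ^ 2 * ‖N‖ ^ 2)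
      + 129 * (1 + B) ^ 2 * ((u⁻¹ - v⁻¹) * ‖N‖ ^ 2) := by
  refine le_trans ?_ (weighted_error_step_real hu huv hB h (norm_nonneg ε) (norm_nonneg Z)
    (norm_nonneg N) (abs_real_inner_le_norm ε Z) (abs_real_inner_le_norm ε N))
  have hv : 1 ≤ v := hu.trans huv
  have hw : 0 ≤ v + 8 * B := by linarith
  generalize hr : (v ^ 2)⁻¹ = r
  have hr0 : 0 ≤ r := by rw [← hr]; positivity
  have hr1 : r ≤ 1 := by rw [← hr]; exact inv_le_one_of_one_le₀ (one_le_pow₀ ‹_›)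
  have key : ‖(1 - r) • (ε + Z) + r • N‖ ^ 2 ≤ (1 - r) ^ 2 * ‖ε‖ ^ 2
      + 2 * (1 - r) ^ 2 * inner ℝ ε Z + 2 * (r * (1 - r)) * inner ℝ ε N
      + (2 * ‖Z‖ ^ 2 + 2 * r ^ 2 * ‖N‖ ^ 2) := by
    have h1 : (1 - r) • (ε + Z) + r • N = (1 - r) • ε + ((1 - r) • Z + r • N) := by
      rw [smul_add, add_assoc]
    have h2 : ‖(1 - r) • Z + r • N‖ ^ 2 ≤ 2 * ‖Z‖ ^ 2 + 2 * r ^ 2 * ‖N‖ ^ 2 := by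
      have h3 : ‖(1 - r) • Z + r • N‖ ≤ ‖Z‖ + r * ‖N‖ := by
        refine (norm_add_le _ _).trans ?_
        rw [norm_smul, norm_smul, Real.norm_of_nonneg hr0, Real.norm_of_nonneg (by linarith)]
        nlinarith [norm_nonneg Z]
      calc _ ≤ (‖Z‖ + r * ‖N‖) ^ 2 := by gcongr
        _ ≤ _ := by nlinarith [sq_nonneg (‖Z‖ - r * ‖N‖)]
    rw [h1, norm_add_sq_real, norm_smul, inner_smul_left, inner_add_right, inner_smul_right,
      inner_smul_right, mul_pow, Real.norm_eq_abs, sq_abs]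
    simp only [conj_trivial]
    nlinarith [h2]
  gcongr

end Recursion

/-! ### Logarithmic estimates. -/

section Sums

/-- A sum of relative increments of an increasing sequence is bounded by a logarithm. -/
lemma sub_div_le_log_sub_log {x y : ℝ} (hx : 0 < x) (hy : 0 < y) :
    (y - x) / y ≤ Real.log y - Real.log x := by
  rw [← Real.log_div hy.ne' hx.ne']
  have := Real.one_sub_inv_le_log_of_pos (div_pos hy hx)
  rw [inv_div] at this
  rwa [sub_div, div_self hy.ne']

/-- `log` is bounded by each of its tangents. -/
lemma log_le_div_add_log {x m : ℝ} (hx : 0 < x) (hm : 0 < m) :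
    Real.log x ≤ x / m - 1 + Real.log m := by
  have := Real.log_le_sub_one_of_pos (div_pos hx hm)
  rw [Real.log_div hx.ne' hm.ne'] at this
  linarith

end Sums

/-! ### Integrating out a fresh sample. -/

section Fresh

variable {Ω 𝒳 Ξ : Type*} [MeasurableSpace Ω] [MeasurableSpace 𝒳] [MeasurableSpace Ξ]
  {P : Measure Ω} [IsProbabilityMeasure P] {𝒟 : Measure Ξ}
  {X : Ω → 𝒳} {ζ : Ω → Ξ}

lemma map_prodMk_fresh (hX : Measurable X) (hζ : Measurable ζ) (hi : IndepFun X ζ P)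
    (hl : P.map ζ = 𝒟) : P.map (fun ω => (X ω, ζ ω)) = (P.map X).prod 𝒟 := by
  rw [(indepFun_iff_map_prod_eq_prod_map_map hX.aemeasurable hζ.aemeasurable).1 hi, hl]

lemma integrable_prod_fresh (hX : Measurable X) (hζ : Measurable ζ) (hi : IndepFun X ζ P)
    (hl : P.map ζ = 𝒟) {h : 𝒳 × Ξ → ℝ} (hm : Measurable h)
    (hint : Integrable (fun ω => h (X ω, ζ ω)) P) : Integrable h ((P.map X).prod 𝒟) := by
  rw [← map_prodMk_fresh hX hζ hi hl]
  exact (integrable_map_measure hm.aestronglyMeasurable (hX.prodMk hζ).aemeasurable).2 hint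

variable [IsProbabilityMeasure 𝒟]

/-- A property that holds almost surely at every fixed point holds almost surely at a random point
that is independent of the sample. -/
lemma ae_fresh (hX : Measurable X) (hζ : Measurable ζ) (hi : IndepFun X ζ P)
    (hl : P.map ζ = 𝒟) {p : 𝒳 × Ξ → Prop} (hp : MeasurableSet {y | p y})
    (h : ∀ x, ∀ᵐ z ∂𝒟, p (x, z)) : ∀ᵐ ω ∂P, p (X ω, ζ ω) := by
  have h1 : ∀ᵐ y ∂(P.map X).prod 𝒟, p y :=
    (Measure.ae_prod_iff_ae_ae hp).2 (Filter.Eventually.of_forall h)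
  rw [← map_prodMk_fresh hX hζ hi hl] at h1
  exact ae_of_ae_map (hX.prodMk hζ).aemeasurable h1

/-- Integrating out a sample that is independent of the past. -/
lemma integral_fresh (hX : Measurable X) (hζ : Measurable ζ) (hi : IndepFun X ζ P)
    (hl : P.map ζ = 𝒟) {h : 𝒳 × Ξ → ℝ} (hm : Measurable h)
    (hint : Integrable (fun ω => h (X ω, ζ ω)) P) :
    ∫ ω, h (X ω, ζ ω) ∂P = ∫ ω, ∫ z, h (X ω, z) ∂𝒟 ∂P := by
  have h1 := integrable_prod_fresh hX hζ hi hl hm hint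
  rw [← integral_map (φ := fun ω => (X ω, ζ ω)) (f := h) (hX.prodMk hζ).aemeasurable
    hm.aestronglyMeasurable, map_prodMk_fresh hX hζ hi hl, integral_prod _ h1,
    integral_map hX.aemeasurable]
  exact h1.integral_prod_left.aestronglyMeasurable

lemma integrable_integral_fresh (hX : Measurable X) (hζ : Measurable ζ) (hi : IndepFun X ζ P)
    (hl : P.map ζ = 𝒟) {h : 𝒳 × Ξ → ℝ} (hm : Measurable h)
    (hint : Integrable (fun ω => h (X ω, ζ ω)) P) :
    Integrable (fun ω => ∫ z, h (X ω, z) ∂𝒟) P :=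
  (integrable_prod_fresh hX hζ hi hl hm hint).integral_prod_left.comp_measurable hX

lemma integral_fresh_le (hX : Measurable X) (hζ : Measurable ζ) (hi : IndepFun X ζ P)
    (hl : P.map ζ = 𝒟) {h : 𝒳 × Ξ → ℝ} (hm : Measurable h)
    (hint : Integrable (fun ω => h (X ω, ζ ω)) P) {G : Ω → ℝ} (hG : Integrable G P)
    (hle : ∀ᵐ ω ∂P, ∫ z, h (X ω, z) ∂𝒟 ≤ G ω) : ∫ ω, h (X ω, ζ ω) ∂P ≤ ∫ ω, G ω ∂P := by
  rw [integral_fresh hX hζ hi hl hm hint]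
  exact integral_mono_ae (integrable_integral_fresh hX hζ hi hl hm hint) hG hle

lemma le_integral_fresh (hX : Measurable X) (hζ : Measurable ζ) (hi : IndepFun X ζ P)
    (hl : P.map ζ = 𝒟) {h : 𝒳 × Ξ → ℝ} (hm : Measurable h)
    (hint : Integrable (fun ω => h (X ω, ζ ω)) P) {G : Ω → ℝ} (hG : Integrable G P)
    (hle : ∀ᵐ ω ∂P, G ω ≤ ∫ z, h (X ω, z) ∂𝒟) : ∫ ω, G ω ∂P ≤ ∫ ω, h (X ω, ζ ω) ∂P := by
  rw [integral_fresh hX hζ hi hl hm hint]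
  exact integral_mono_ae hG (integrable_integral_fresh hX hζ hi hl hm hint) hle

end Fresh

/-- Jensen's inequality for the squared norm. -/
lemma norm_integral_sq_le {Ω E : Type*} [MeasurableSpace Ω] {μ : Measure Ω}
    [IsProbabilityMeasure μ] [NormedAddCommGroup E] [NormedSpace ℝ E] {g : Ω → E}
    (hg : Integrable g μ) (hg2 : Integrable (fun ω => ‖g ω‖ ^ 2) μ) :
    ‖∫ ω, g ω ∂μ‖ ^ 2 ≤ ∫ ω, ‖g ω‖ ^ 2 ∂μ := by
  have h0 : ‖∫ ω, g ω ∂μ‖ ^ 2 ≤ (∫ ω, ‖g ω‖ ∂μ) ^ 2 := by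
    gcongr; exact norm_integral_le_integral_norm g
  refine h0.trans ?_
  set c := ∫ ω, ‖g ω‖ ∂μ
  have h1 : 0 ≤ ∫ ω, (‖g ω‖ - c) ^ 2 ∂μ := integral_nonneg fun ω => sq_nonneg _
  have h2 : ∫ ω, (‖g ω‖ - c) ^ 2 ∂μ = ∫ ω, ‖g ω‖ ^ 2 ∂μ - 2 * c * c + c ^ 2 := by
    have : (fun ω => (‖g ω‖ - c) ^ 2) = fun ω => ‖g ω‖ ^ 2 - 2 * c * ‖g ω‖ + c ^ 2 := by
      ext ω; ring
    have h3 : Integrable (fun ω => 2 * c * ‖g ω‖) μ := hg.norm.const_mul _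
    have h4 : Integrable (fun ω => ‖g ω‖ ^ 2 - 2 * c * ‖g ω‖) μ := hg2.sub h3
    rw [this, integral_add h4 (integrable_const _), integral_sub hg2 h3, integral_const_mul]
    simp [c]
  nlinarith

/-! ### Consequences of the assumptions at fixed points. -/

section Problem

variable {d : ℕ} {Ξ : Type*} [MeasurableSpace Ξ] {𝒟 : Measure Ξ}
  {f : EuclideanSpace ℝ (Fin d) → Ξ → ℝ} {σ β σh : ℝ}

/-- The full gradient `∇F`. -/
noncomputable def meanGrad {d : ℕ} {Ξ : Type*} [MeasurableSpace Ξ] (𝒟 : Measure Ξ)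
    (f : EuclideanSpace ℝ (Fin d) → Ξ → ℝ) (x : EuclideanSpace ℝ (Fin d)) :
    EuclideanSpace ℝ (Fin d) :=
  gradient (objective 𝒟 f) x

lemma Assumptions.measurable_sampleGrad (h : Assumptions 𝒟 f σ β σh)
    (x : EuclideanSpace ℝ (Fin d)) : Measurable (sampleGrad f x) :=
  h.measurable_grad.comp (measurable_const.prodMk measurable_id)

variable [IsProbabilityMeasure 𝒟]

/-- Jensen's inequality transfers the averaged smoothness of the samples to the mean gradient, by
unbiasedness. -/
lemma Assumptions.norm_meanGrad_sub_le (h : Assumptions 𝒟 f σ β σh)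
    (x y : EuclideanSpace ℝ (Fin d)) : ‖meanGrad 𝒟 f x - meanGrad 𝒟 f y‖ ≤ β * ‖x - y‖ := by
  refine le_of_sq_le_sq ?_ (mul_nonneg h.beta_nonneg (norm_nonneg _))
  rw [meanGrad, meanGrad, ← h.unbiased, ← h.unbiased,
    ← integral_sub (h.integrable_grad x) (h.integrable_grad y), mul_pow]
  exact (norm_integral_sq_le ((h.integrable_grad x).sub (h.integrable_grad y))
    (h.integrable_smooth x y)).trans (h.smooth x y)

lemma Assumptions.continuous_meanGrad (h : Assumptions 𝒟 f σ β σh) :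
    Continuous (meanGrad 𝒟 f) := by
  have : LipschitzWith β.toNNReal (meanGrad 𝒟 f) := LipschitzWith.of_dist_le_mul fun x y => by
    rw [dist_eq_norm, dist_eq_norm, Real.coe_toNNReal _ h.beta_nonneg]
    exact h.norm_meanGrad_sub_le x y
  exact this.continuous

lemma Assumptions.measurable_meanGrad (h : Assumptions 𝒟 f σ β σh) :
    Measurable (meanGrad 𝒟 f) := h.continuous_meanGrad.measurable

/-- The noise of the stochastic gradient is almost surely bounded by `2 σh`. -/
lemma Assumptions.ae_norm_sub_meanGrad_le (h : Assumptions 𝒟 f σ β σh)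
    (x : EuclideanSpace ℝ (Fin d)) :
    ∀ᵐ z ∂𝒟, ‖sampleGrad f x z - meanGrad 𝒟 f x‖ ≤ 2 * σh := by
  filter_upwards [h.bounded_diff x] with z hz
  have h1 : sampleGrad f x z - meanGrad 𝒟 f x
      = ∫ z', (sampleGrad f x z - sampleGrad f x z') ∂𝒟 := by
    rw [integral_sub (integrable_const _) (h.integrable_grad x), h.unbiased]
    simp [meanGrad]
  rw [h1]
  have := norm_integral_le_of_norm_le_const (μ := 𝒟) hz
  simpa using this

/-- The noise at `x` is on average at most the difference to a fresh stochastic gradient. -/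
lemma Assumptions.norm_sub_meanGrad_sq_le (h : Assumptions 𝒟 f σ β σh)
    (x : EuclideanSpace ℝ (Fin d)) (z : Ξ) :
    ‖sampleGrad f x z - meanGrad 𝒟 f x‖ ^ 2
      ≤ ∫ z', ‖sampleGrad f x z - sampleGrad f x z'‖ ^ 2 ∂𝒟 := by
  have h1 : sampleGrad f x z - meanGrad 𝒟 f x
      = ∫ z', (sampleGrad f x z - sampleGrad f x z') ∂𝒟 := by
    rw [integral_sub (integrable_const _) (h.integrable_grad x), h.unbiased]
    simp [meanGrad]
  rw [h1]
  refine norm_integral_sq_le ((integrable_const _).sub (h.integrable_grad x)) ?_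
  have hv := h.integrable_variance x
  have hb : Integrable (fun z' => 2 * ‖sampleGrad f x z - gradient (objective 𝒟 f) x‖ ^ 2
      + 2 * ‖sampleGrad f x z' - gradient (objective 𝒟 f) x‖ ^ 2) 𝒟 :=
    (integrable_const _).add (hv.const_mul 2)
  refine hb.mono' ((measurable_const.sub (h.measurable_sampleGrad x)).norm.pow_const 2
    |>.aestronglyMeasurable) (Filter.Eventually.of_forall fun z' => ?_)
  rw [Real.norm_of_nonneg (sq_nonneg _)]
  have := norm_sub_le (sampleGrad f x z - gradient (objective 𝒟 f) x)
    (sampleGrad f x z' - gradient (objective 𝒟 f) x)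
  rw [sub_sub_sub_cancel_right] at this
  nlinarith [norm_nonneg (sampleGrad f x z - sampleGrad f x z'),
    sq_nonneg (‖sampleGrad f x z - gradient (objective 𝒟 f) x‖
      - ‖sampleGrad f x z' - gradient (objective 𝒟 f) x‖)]

/-- The centred difference of the stochastic gradients at two points. -/
noncomputable def gradNoiseDiff {d : ℕ} {Ξ : Type*} [MeasurableSpace Ξ] (𝒟 : Measure Ξ)
    (f : EuclideanSpace ℝ (Fin d) → Ξ → ℝ) (x y : EuclideanSpace ℝ (Fin d)) (z : Ξ) :
    EuclideanSpace ℝ (Fin d) :=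
  (sampleGrad f y z - meanGrad 𝒟 f y) - (sampleGrad f x z - meanGrad 𝒟 f x)

lemma Assumptions.integral_inner_noise (h : Assumptions 𝒟 f σ β σh)
    (v x : EuclideanSpace ℝ (Fin d)) :
    ∫ z, inner ℝ v (sampleGrad f x z - meanGrad 𝒟 f x) ∂𝒟 = 0 := by
  have hi : Integrable (fun z => sampleGrad f x z - meanGrad 𝒟 f x) 𝒟 :=
    (h.integrable_grad x).sub (integrable_const _)
  rw [integral_inner hi, integral_sub (h.integrable_grad x) (integrable_const _), h.unbiased]
  simp [meanGrad]

lemma Assumptions.integral_inner_gradNoiseDiff (h : Assumptions 𝒟 f σ β σh)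
    (v x y : EuclideanSpace ℝ (Fin d)) :
    ∫ z, inner ℝ v (gradNoiseDiff 𝒟 f x y z) ∂𝒟 = 0 := by
  have hi : ∀ x, Integrable (fun z => inner ℝ v (sampleGrad f x z - meanGrad 𝒟 f x)) 𝒟 :=
    fun x => ((h.integrable_grad x).sub (integrable_const _)).const_inner v
  simp only [gradNoiseDiff, inner_sub_right (x := v) (y := sampleGrad f y _ - meanGrad 𝒟 f y)]
  rw [integral_sub (hi y) (hi x), h.integral_inner_noise, h.integral_inner_noise, sub_zero]

/-- The stochastic and the mean gradient difference both have second moment at most `β² ‖y - x‖²`;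
the crude `(a + b)² ≤ 2a² + 2b²` gives the factor `4`. -/
lemma Assumptions.integral_norm_gradNoiseDiff_sq_le (h : Assumptions 𝒟 f σ β σh)
    (x y : EuclideanSpace ℝ (Fin d)) :
    ∫ z, ‖gradNoiseDiff 𝒟 f x y z‖ ^ 2 ∂𝒟 ≤ 4 * β ^ 2 * ‖y - x‖ ^ 2 := by
  have hint : Integrable (fun z => 2 * ‖sampleGrad f y z - sampleGrad f x z‖ ^ 2
      + 2 * (β * ‖y - x‖) ^ 2) 𝒟 :=
    ((h.integrable_smooth y x).const_mul 2).add (integrable_const _)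
  have hle : ∀ z, ‖gradNoiseDiff 𝒟 f x y z‖ ^ 2
      ≤ 2 * ‖sampleGrad f y z - sampleGrad f x z‖ ^ 2 + 2 * (β * ‖y - x‖) ^ 2 := fun z => by
    have h1 := norm_sub_le (sampleGrad f y z - sampleGrad f x z)
      (meanGrad 𝒟 f y - meanGrad 𝒟 f x)
    rw [sub_sub_sub_comm] at h1
    have h2 := h.norm_meanGrad_sub_le y x
    have h3 : ‖gradNoiseDiff 𝒟 f x y z‖
        ≤ ‖sampleGrad f y z - sampleGrad f x z‖ + β * ‖y - x‖ := by
      rw [gradNoiseDiff]; linarith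
    have h4 := pow_le_pow_left₀ (norm_nonneg _) h3 2
    nlinarith [sq_nonneg (‖sampleGrad f y z - sampleGrad f x z‖ - β * ‖y - x‖)]
  have := integral_mono_of_nonneg (μ := 𝒟) (Filter.Eventually.of_forall fun z => sq_nonneg _) hint
    (Filter.Eventually.of_forall hle)
  refine this.trans ?_
  rw [integral_add ((h.integrable_smooth y x).const_mul 2) (integrable_const _),
    integral_const_mul]
  have h5 := h.smooth y x
  simp only [integral_const, probReal_univ, smul_eq_mul, one_mul]
  nlinarith

/-- The descent inequality for `F`. -/
lemma Assumptions.objective_sub_le (h : Assumptions 𝒟 f σ β σh)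
    (x v : EuclideanSpace ℝ (Fin d)) :
    objective 𝒟 f (x + v) ≤ objective 𝒟 f x + inner ℝ (meanGrad 𝒟 f x) v + β * ‖v‖ ^ 2 := by
  have hd : ∀ s : ℝ, HasDerivAt (fun s : ℝ => objective 𝒟 f (x + s • v))
      (inner ℝ (meanGrad 𝒟 f (x + s • v)) v) s := fun s => by
    have h1 : HasFDerivAt (objective 𝒟 f) _ (x + s • v) :=
      (h.differentiable_objective (x + s • v)).hasGradientAt.hasFDerivAt
    have h2 : HasDerivAt (fun s : ℝ => x + s • v) v s := by
      simpa using ((hasDerivAt_id s).smul_const v).const_add x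
    exact h1.comp_hasDerivAt s h2
  -- The mean value theorem on the segment suffices; it gives `β` in place of the sharper `β / 2`.
  obtain ⟨c, hc, he⟩ := exists_hasDerivAt_eq_slope (fun s : ℝ => objective 𝒟 f (x + s • v)) _
    (zero_lt_one) (fun s _ => (hd s).continuousAt.continuousWithinAt) (fun s _ => hd s)
  have h3 : inner ℝ (meanGrad 𝒟 f (x + c • v) - meanGrad 𝒟 f x) v ≤ β * ‖v‖ ^ 2 := by
    refine (real_inner_le_norm _ _).trans ?_
    have h4 := h.norm_meanGrad_sub_le (x + c • v) x
    rw [add_sub_cancel_left, norm_smul, Real.norm_of_nonneg hc.1.le] at h4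
    have h5 : β * (c * ‖v‖) ≤ β * ‖v‖ :=
      mul_le_mul_of_nonneg_left (mul_le_of_le_one_left (norm_nonneg _) hc.2.le) h.beta_nonneg
    calc _ ≤ β * ‖v‖ * ‖v‖ := by gcongr; exact h4.trans h5
      _ = _ := by ring
  rw [inner_sub_left, he] at h3
  simp at h3
  linarith

end Problem

/-! ### Deterministic identities along a run. -/

section Path

variable {d : ℕ} {Ξ : Type*}

/-- The iterate `x_k`. -/
noncomputable def pathX (f : EuclideanSpace ℝ (Fin d) → Ξ → ℝ) (x₁ : EuclideanSpace ℝ (Fin d))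
    (z : ℕ → Ξ) (k : ℕ) : EuclideanSpace ℝ (Fin d) := (run f stdParams x₁ z k).x

/-- The momentum `d_k`. -/
noncomputable def pathM (f : EuclideanSpace ℝ (Fin d) → Ξ → ℝ) (x₁ : EuclideanSpace ℝ (Fin d))
    (z : ℕ → Ξ) (k : ℕ) : EuclideanSpace ℝ (Fin d) := (run f stdParams x₁ z k).mom

/-- `1 + ∑_{i ≤ k} ‖d_i‖²`. -/
noncomputable def pathD (f : EuclideanSpace ℝ (Fin d) → Ξ → ℝ) (x₁ : EuclideanSpace ℝ (Fin d))
    (z : ℕ → Ξ) (k : ℕ) : ℝ := 1 + (run f stdParams x₁ z k).momSum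

/-- `a_k^{-1/2}`, the cube root of one plus the sum of the squared gradient differences. -/
noncomputable def pathU (f : EuclideanSpace ℝ (Fin d) → Ξ → ℝ) (x₁ : EuclideanSpace ℝ (Fin d))
    (z : ℕ → Ξ) (k : ℕ) : ℝ := (1 + (run f stdParams x₁ z k).diffSum) ^ (1 / 3 : ℝ)

/-- `∇f(x_k, ξ_k) - ∇f(x_k, ξ_{k+1})`. -/
noncomputable def pathDiff (f : EuclideanSpace ℝ (Fin d) → Ξ → ℝ) (x₁ : EuclideanSpace ℝ (Fin d))
    (z : ℕ → Ξ) (k : ℕ) : EuclideanSpace ℝ (Fin d) :=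
  sampleGrad f (pathX f x₁ z k) (z k) - sampleGrad f (pathX f x₁ z k) (z (k + 1))

/-- The momentum error `d_k - ∇F(x_k)`. -/
noncomputable def pathErr [MeasurableSpace Ξ] (𝒟 : Measure Ξ)
    (f : EuclideanSpace ℝ (Fin d) → Ξ → ℝ) (x₁ : EuclideanSpace ℝ (Fin d))
    (z : ℕ → Ξ) (k : ℕ) : EuclideanSpace ℝ (Fin d) :=
  pathM f x₁ z k - meanGrad 𝒟 f (pathX f x₁ z k)

/-- The gradient noise `∇f(x_k, ξ_j) - ∇F(x_k)`. -/
noncomputable def pathNoise [MeasurableSpace Ξ] (𝒟 : Measure Ξ)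
    (f : EuclideanSpace ℝ (Fin d) → Ξ → ℝ) (x₁ : EuclideanSpace ℝ (Fin d))
    (z : ℕ → Ξ) (k j : ℕ) : EuclideanSpace ℝ (Fin d) :=
  sampleGrad f (pathX f x₁ z k) (z j) - meanGrad 𝒟 f (pathX f x₁ z k)

/-- The centred gradient difference of consecutive iterates. -/
noncomputable def pathZ [MeasurableSpace Ξ] (𝒟 : Measure Ξ)
    (f : EuclideanSpace ℝ (Fin d) → Ξ → ℝ) (x₁ : EuclideanSpace ℝ (Fin d))
    (z : ℕ → Ξ) (k : ℕ) : EuclideanSpace ℝ (Fin d) :=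
  gradNoiseDiff 𝒟 f (pathX f x₁ z k) (pathX f x₁ z (k + 1)) (z (k + 1))

variable (f : EuclideanSpace ℝ (Fin d) → Ξ → ℝ) (x₁ : EuclideanSpace ℝ (Fin d)) (z : ℕ → Ξ)

lemma diffSum_nonneg (k : ℕ) : 0 ≤ (run f stdParams x₁ z k).diffSum := by
  induction k with
  | zero => simp [run, init]
  | succ k ih => simp only [run, step]; positivity

lemma momSum_nonneg (k : ℕ) : 0 ≤ (run f stdParams x₁ z k).momSum := by
  induction k with
  | zero => simp only [run, init]; positivity
  | succ k ih => simp only [run, step]; positivity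

lemma pathX_zero : pathX f x₁ z 0 = x₁ := rfl

lemma pathD_zero : pathD f x₁ z 0 = 1 + ‖pathM f x₁ z 0‖ ^ 2 := rfl

lemma pathD_succ (k : ℕ) :
    pathD f x₁ z (k + 1) = pathD f x₁ z k + ‖pathM f x₁ z (k + 1)‖ ^ 2 := by
  simp only [pathD, pathM, run, step, add_assoc]

lemma one_le_pathD (k : ℕ) : 1 ≤ pathD f x₁ z k := by
  have := momSum_nonneg f x₁ z k
  rw [pathD]; linarith

lemma pathD_mono : Monotone (pathD f x₁ z) :=
  monotone_nat_of_le_succ fun k => by rw [pathD_succ]; linarith [sq_nonneg ‖pathM f x₁ z (k + 1)‖]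

lemma norm_pathM_sq_le (k : ℕ) : ‖pathM f x₁ z k‖ ^ 2 ≤ pathD f x₁ z k := by
  cases k with
  | zero => rw [pathD_zero]; linarith
  | succ k => rw [pathD_succ]; linarith [one_le_pathD f x₁ z k]

lemma sum_norm_pathM_sq (n : ℕ) :
    ∑ k ∈ Finset.range (n + 1), ‖pathM f x₁ z k‖ ^ 2 = pathD f x₁ z n - 1 := by
  induction n with
  | zero => simp [pathD_zero]
  | succ n ih => rw [Finset.sum_range_succ, ih, pathD_succ]; ring

lemma pathU_cube (k : ℕ) : pathU f x₁ z k ^ 3 = 1 + (run f stdParams x₁ z k).diffSum := by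
  have := diffSum_nonneg f x₁ z k
  rw [pathU, ← Real.rpow_natCast, ← Real.rpow_mul (by linarith)]
  norm_num

lemma one_le_pathU (k : ℕ) : 1 ≤ pathU f x₁ z k :=
  Real.one_le_rpow (by linarith [diffSum_nonneg f x₁ z k]) (by norm_num)

lemma pathU_zero : pathU f x₁ z 0 = 1 := by simp [pathU, run, init]

lemma pathU_succ_cube (k : ℕ) :
    pathU f x₁ z (k + 1) ^ 3 = pathU f x₁ z k ^ 3 + ‖pathDiff f x₁ z k‖ ^ 2 := by
  rw [pathU_cube, pathU_cube]
  simp only [run, step, pathDiff, pathX, add_assoc]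

lemma pathU_mono : Monotone (pathU f x₁ z) :=
  monotone_nat_of_le_succ fun k => by
    refine le_of_pow_le_pow_left₀ three_ne_zero (by linarith [one_le_pathU f x₁ z (k + 1)]) ?_
    rw [pathU_succ_cube]; linarith [sq_nonneg ‖pathDiff f x₁ z k‖]

lemma momentumCoeff_run (k : ℕ) :
    momentumCoeff stdParams (run f stdParams x₁ z k).diffSum = (pathU f x₁ z k ^ 2)⁻¹ := by
  have := diffSum_nonneg f x₁ z k
  have h1 : pathU f x₁ z k ^ 2 = (1 + (run f stdParams x₁ z k).diffSum) ^ (2 / 3 : ℝ) := by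
    rw [pathU, ← Real.rpow_natCast, ← Real.rpow_mul (by linarith)]
    norm_num
  rw [momentumCoeff, h1, ← Real.rpow_neg (by linarith)]
  norm_num [stdParams]

/-- The step size denominator `b_k`. -/
lemma stepCoeff_run (k : ℕ) :
    stepCoeff stdParams (run f stdParams x₁ z k) = √(pathD f x₁ z k) * √(pathU f x₁ z k) := by
  have hu := one_le_pathU f x₁ z k
  rw [stepCoeff, momentumCoeff_run, Real.sqrt_eq_rpow, Real.sqrt_eq_rpow, pathD]
  have h1 : ((pathU f x₁ z k ^ 2)⁻¹) ^ stdParams.q = (pathU f x₁ z k ^ (1 / 2 : ℝ))⁻¹ := by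
    rw [Real.inv_rpow (by positivity), ← Real.rpow_natCast, ← Real.rpow_mul (by linarith)]
    norm_num [stdParams]
  rw [h1, div_inv_eq_mul]
  norm_num [stdParams]

lemma pathX_succ (k : ℕ) : pathX f x₁ z (k + 1)
    = pathX f x₁ z k - (√(pathD f x₁ z k) * √(pathU f x₁ z k))⁻¹ • pathM f x₁ z k := by
  rw [← stepCoeff_run]
  simp [pathX, pathM, run, step, stdParams]

lemma pathM_succ (k : ℕ) : pathM f x₁ z (k + 1)
    = sampleGrad f (pathX f x₁ z (k + 1)) (z (k + 1)) + (1 - (pathU f x₁ z (k + 1) ^ 2)⁻¹) •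
      (pathM f x₁ z k - sampleGrad f (pathX f x₁ z k) (z (k + 1))) := by
  rw [← momentumCoeff_run]
  simp only [pathX, pathM, run, step]

/-- The factor `u` in the denominator is what later cancels the weight `u` in front of `‖Z‖²`. -/
lemma norm_pathX_succ_sub_sq (k : ℕ) : ‖pathX f x₁ z (k + 1) - pathX f x₁ z k‖ ^ 2
    = ‖pathM f x₁ z k‖ ^ 2 / (pathD f x₁ z k * pathU f x₁ z k) := by
  have h1 := one_le_pathD f x₁ z k
  have h2 := one_le_pathU f x₁ z k
  rw [pathX_succ, sub_sub_cancel_left, norm_neg, norm_smul, mul_pow, norm_inv, inv_pow,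
    Real.norm_of_nonneg (by positivity), mul_pow, Real.sq_sqrt (by linarith),
    Real.sq_sqrt (by linarith)]
  ring

/-- Each step is short because `D` contains the current squared momentum. This keeps the iterates in
a fixed ball, which gives integrability. -/
lemma norm_pathX_succ_sub_le (k : ℕ) : ‖pathX f x₁ z (k + 1) - pathX f x₁ z k‖ ≤ 1 := by
  refine (sq_le_one_iff₀ (norm_nonneg _)).1 ?_
  have h1 := one_le_pathD f x₁ z k
  have h2 := one_le_pathU f x₁ z k
  have h3 := norm_pathM_sq_le f x₁ z k
  rw [norm_pathX_succ_sub_sq, div_le_one (by positivity)]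
  nlinarith

/-- The sum of the relative squared momenta is logarithmic. -/
lemma sum_norm_pathM_sq_div_le (n : ℕ) :
    ∑ k ∈ Finset.range (n + 1), ‖pathM f x₁ z k‖ ^ 2 / pathD f x₁ z k
      ≤ Real.log (pathD f x₁ z n) := by
  induction n with
  | zero =>
    have h := sub_div_le_log_sub_log one_pos (by linarith [one_le_pathD f x₁ z 0] :
      0 < pathD f x₁ z 0)
    rw [Real.log_one, sub_zero] at h
    refine le_trans (le_of_eq ?_) h
    rw [zero_add, Finset.sum_range_one, pathD_zero, add_sub_cancel_left]
  | succ n ih =>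
    have h := sub_div_le_log_sub_log (by linarith [one_le_pathD f x₁ z n] : 0 < pathD f x₁ z n)
      (by linarith [one_le_pathD f x₁ z (n + 1)] : 0 < pathD f x₁ z (n + 1))
    rw [Finset.sum_range_succ]
    have h2 : pathD f x₁ z (n + 1) - pathD f x₁ z n = ‖pathM f x₁ z (n + 1)‖ ^ 2 := by
      rw [pathD_succ]; ring
    rw [h2] at h
    linarith

/-- The sum of the squared gradient differences, weighted by `(u + 8B) / u⁴`, is logarithmic. -/
lemma sum_weight_norm_pathDiff_sq_le {B : ℝ} (hB : 0 ≤ B)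
    (hd : ∀ k, ‖pathDiff f x₁ z k‖ ^ 2 ≤ B) (n : ℕ) :
    ∑ k ∈ Finset.range n, (pathU f x₁ z k + 8 * B) * ((pathU f x₁ z k ^ 2)⁻¹) ^ 2
        * ‖pathDiff f x₁ z k‖ ^ 2
      ≤ (1 + 8 * B) * (1 + B) * Real.log (pathU f x₁ z n ^ 3) := by
  have hstep : ∀ k, (pathU f x₁ z k + 8 * B) * ((pathU f x₁ z k ^ 2)⁻¹) ^ 2
      * ‖pathDiff f x₁ z k‖ ^ 2 ≤ (1 + 8 * B) * (1 + B) * Real.log (pathU f x₁ z (k + 1) ^ 3)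
        - (1 + 8 * B) * (1 + B) * Real.log (pathU f x₁ z k ^ 3) := fun k => by
    have hu := one_le_pathU f x₁ z k
    have hv := one_le_pathU f x₁ z (k + 1)
    have hs := pathU_succ_cube f x₁ z k
    have hdk := hd k
    have hlog := sub_div_le_log_sub_log (x := pathU f x₁ z k ^ 3)
      (y := pathU f x₁ z (k + 1) ^ 3) (by positivity) (by positivity)
    have hq : 0 ≤ ‖pathDiff f x₁ z k‖ ^ 2 := sq_nonneg _
    generalize pathU f x₁ z k = u at *
    generalize pathU f x₁ z (k + 1) = v at *
    generalize ‖pathDiff f x₁ z k‖ ^ 2 = q at *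
    have hu3 : 1 ≤ u ^ 3 := one_le_pow₀ hu
    rw [← mul_sub]
    have h1 : (u + 8 * B) * ((u ^ 2)⁻¹) ^ 2 ≤ (1 + 8 * B) * (u ^ 3)⁻¹ := by
      have : (u + 8 * B) * ((u ^ 2)⁻¹) ^ 2 = (u + 8 * B) / u * (u ^ 3)⁻¹ := by field_simp
      rw [this]
      gcongr
      rw [div_le_iff₀ (by linarith)]
      nlinarith
    -- The logarithmic estimate needs the new value `v³` in the denominator; bounded increments and
    -- `u ≥ 1` make the exchange cost only `1 + B`.
    have h2 : (u ^ 3)⁻¹ ≤ (1 + B) * (v ^ 3)⁻¹ := by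
      rw [← div_eq_mul_inv, le_div_iff₀ (by positivity), inv_mul_le_iff₀ (by positivity), hs]
      nlinarith
    have h3 : v ^ 3 - u ^ 3 = q := by linarith
    rw [h3] at hlog
    calc _ ≤ (1 + 8 * B) * (u ^ 3)⁻¹ * q := by gcongr
      _ ≤ (1 + 8 * B) * ((1 + B) * (v ^ 3)⁻¹) * q := by gcongr
      _ = (1 + 8 * B) * (1 + B) * (q / v ^ 3) := by ring
      _ ≤ _ := by gcongr
  refine (Finset.sum_le_sum fun k _ => hstep k).trans ?_
  rw [Finset.sum_range_sub (fun k => (1 + 8 * B) * (1 + B) * Real.log (pathU f x₁ z k ^ 3)),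
    pathU_zero]
  simp

end Path

/-! ### Pathwise inequalities for the errors, momenta and gradients. -/

section PathProblem

variable {d : ℕ} {Ξ : Type*} [MeasurableSpace Ξ] {𝒟 : Measure Ξ}
  {f : EuclideanSpace ℝ (Fin d) → Ξ → ℝ} {σ β σh : ℝ} (x₁ : EuclideanSpace ℝ (Fin d))
  (z : ℕ → Ξ)

lemma pathErr_zero : pathErr 𝒟 f x₁ z 0 = pathNoise 𝒟 f x₁ z 0 0 := rfl

lemma pathDiff_eq (k : ℕ) :
    pathDiff f x₁ z k = pathNoise 𝒟 f x₁ z k k - pathNoise 𝒟 f x₁ z k (k + 1) := by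
  rw [pathDiff, pathNoise, pathNoise, sub_sub_sub_cancel_right]

lemma pathZ_eq (k : ℕ) : pathZ 𝒟 f x₁ z k
    = pathNoise 𝒟 f x₁ z (k + 1) (k + 1) - pathNoise 𝒟 f x₁ z k (k + 1) := rfl

/-- The fresh noise at `x_{k+1}` is split in proportions `a` and `1 - a`; the second part joins the
noise at `x_k` from the same sample to form `Z`, which smoothness makes small. -/
lemma pathErr_succ (k : ℕ) : pathErr 𝒟 f x₁ z (k + 1)
    = (1 - (pathU f x₁ z (k + 1) ^ 2)⁻¹) • (pathErr 𝒟 f x₁ z k + pathZ 𝒟 f x₁ z k)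
      + (pathU f x₁ z (k + 1) ^ 2)⁻¹ • pathNoise 𝒟 f x₁ z (k + 1) (k + 1) := by
  rw [pathZ_eq, pathErr, pathM_succ, pathErr, pathNoise, pathNoise]
  generalize (pathU f x₁ z (k + 1) ^ 2)⁻¹ = r
  module

/-- The noise along the path is bounded by `2 σh`. -/
def NoiseBound {d : ℕ} {Ξ : Type*} [MeasurableSpace Ξ] (𝒟 : Measure Ξ)
    (f : EuclideanSpace ℝ (Fin d) → Ξ → ℝ) (x₁ : EuclideanSpace ℝ (Fin d)) (σh : ℝ)
    (z : ℕ → Ξ) : Prop :=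
  ∀ k, ‖pathNoise 𝒟 f x₁ z k k‖ ≤ 2 * σh ∧ ‖pathNoise 𝒟 f x₁ z k (k + 1)‖ ≤ 2 * σh

variable {x₁ z}

lemma NoiseBound.norm_pathDiff_sq_le (h : NoiseBound 𝒟 f x₁ σh z) (k : ℕ) :
    ‖pathDiff f x₁ z k‖ ^ 2 ≤ 16 * σh ^ 2 := by
  have h1 : ‖pathDiff f x₁ z k‖ ≤ 4 * σh := by
    rw [pathDiff_eq (𝒟 := 𝒟)]
    refine (norm_sub_le _ _).trans ?_
    linarith [(h k).1, (h k).2]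
  calc _ ≤ (4 * σh) ^ 2 := by gcongr
    _ = _ := by ring

/-- The term of the error recursion that is linear in the noise. -/
noncomputable def pathLin {d : ℕ} {Ξ : Type*} [MeasurableSpace Ξ] (𝒟 : Measure Ξ)
    (f : EuclideanSpace ℝ (Fin d) → Ξ → ℝ) (x₁ : EuclideanSpace ℝ (Fin d)) (B : ℝ) (z : ℕ → Ξ)
    (k : ℕ) : ℝ :=
  2 * ((pathU f x₁ z k + 8 * B) * (1 - (pathU f x₁ z k ^ 2)⁻¹) ^ 2)
      * inner ℝ (pathErr 𝒟 f x₁ z k) (pathZ 𝒟 f x₁ z k)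
    + 2 * ((pathU f x₁ z k + 8 * B) * ((pathU f x₁ z k ^ 2)⁻¹ * (1 - (pathU f x₁ z k ^ 2)⁻¹)))
      * inner ℝ (pathErr 𝒟 f x₁ z k) (pathNoise 𝒟 f x₁ z (k + 1) (k + 1))

/-- The weight `(u + 8B) / u⁴`. -/
noncomputable def pathWeight {d : ℕ} {Ξ : Type*}
    (f : EuclideanSpace ℝ (Fin d) → Ξ → ℝ) (x₁ : EuclideanSpace ℝ (Fin d)) (B : ℝ) (z : ℕ → Ξ)
    (k : ℕ) : ℝ :=
  (pathU f x₁ z k + 8 * B) * ((pathU f x₁ z k ^ 2)⁻¹) ^ 2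

/-- The weighted sum of the squared errors. -/
noncomputable def pathW {d : ℕ} {Ξ : Type*} [MeasurableSpace Ξ] (𝒟 : Measure Ξ)
    (f : EuclideanSpace ℝ (Fin d) → Ξ → ℝ) (x₁ : EuclideanSpace ℝ (Fin d)) (z : ℕ → Ξ)
    (n : ℕ) : ℝ :=
  ∑ k ∈ Finset.range n, ‖pathErr 𝒟 f x₁ z k‖ ^ 2 / pathU f x₁ z k

lemma pathW_nonneg (n : ℕ) : 0 ≤ pathW 𝒟 f x₁ z n :=
  Finset.sum_nonneg fun k _ => div_nonneg (sq_nonneg _) (by linarith [one_le_pathU f x₁ z k])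

/-- The summed error recursion along a path. -/
lemma NoiseBound.pathW_le (h : NoiseBound 𝒟 f x₁ σh z) {B : ℝ} (hB : B = 16 * σh ^ 2) (n : ℕ) :
    3 / 8 * pathW 𝒟 f x₁ z n ≤ (1 + 8 * B) * ‖pathErr 𝒟 f x₁ z 0‖ ^ 2
      + ∑ k ∈ Finset.range n, pathLin 𝒟 f x₁ B z k
      + 300 * (1 + B) ^ 2 * ∑ k ∈ Finset.range n, pathU f x₁ z k * ‖pathZ 𝒟 f x₁ z k‖ ^ 2
      + 2 * ∑ k ∈ Finset.range n,
          pathWeight f x₁ B z (k + 1) * ‖pathNoise 𝒟 f x₁ z (k + 1) (k + 1)‖ ^ 2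
      + 129 * (1 + B) ^ 3 := by
  have hB0 : 0 ≤ B := by rw [hB]; positivity
  -- For the induction the potential is kept on the left, and the constant carries the factor `1 - 1
  -- / u_n`, so that each step consumes a telescoping difference.
  have key : ∀ n, (pathU f x₁ z n + 8 * B) * ‖pathErr 𝒟 f x₁ z n‖ ^ 2
      + 3 / 8 * pathW 𝒟 f x₁ z n ≤ (1 + 8 * B) * ‖pathErr 𝒟 f x₁ z 0‖ ^ 2
      + ∑ k ∈ Finset.range n, pathLin 𝒟 f x₁ B z k
      + 300 * (1 + B) ^ 2 * ∑ k ∈ Finset.range n, pathU f x₁ z k * ‖pathZ 𝒟 f x₁ z k‖ ^ 2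
      + 2 * ∑ k ∈ Finset.range n,
          pathWeight f x₁ B z (k + 1) * ‖pathNoise 𝒟 f x₁ z (k + 1) (k + 1)‖ ^ 2
      + 129 * (1 + B) ^ 3 * (1 - (pathU f x₁ z n)⁻¹) := by
    intro n
    induction n with
    | zero => simp [pathW, pathU_zero]
    | succ n ih =>
      have hs := weighted_error_step (one_le_pathU f x₁ z n) (pathU_mono f x₁ z n.le_succ) hB0
        (by rw [pathU_succ_cube, hB]; gcongr; exact h.norm_pathDiff_sq_le n)
        (pathErr 𝒟 f x₁ z n) (pathZ 𝒟 f x₁ z n) (pathNoise 𝒟 f x₁ z (n + 1) (n + 1))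
      rw [← pathErr_succ] at hs
      have hN : ‖pathNoise 𝒟 f x₁ z (n + 1) (n + 1)‖ ^ 2 ≤ 1 + B := by
        calc _ ≤ (2 * σh) ^ 2 := by gcongr; exact (h (n + 1)).1
          _ ≤ _ := by rw [hB]; nlinarith [sq_nonneg σh]
      have hu : 0 ≤ (pathU f x₁ z n)⁻¹ - (pathU f x₁ z (n + 1))⁻¹ := by
        have := one_le_pathU f x₁ z n
        exact sub_nonneg.2 (inv_anti₀ (by linarith) (pathU_mono f x₁ z n.le_succ))
      have hN2 : 129 * (1 + B) ^ 2 * (((pathU f x₁ z n)⁻¹ - (pathU f x₁ z (n + 1))⁻¹)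
          * ‖pathNoise 𝒟 f x₁ z (n + 1) (n + 1)‖ ^ 2)
          ≤ 129 * (1 + B) ^ 3 * ((pathU f x₁ z n)⁻¹ - (pathU f x₁ z (n + 1))⁻¹) := by
        calc _ ≤ 129 * (1 + B) ^ 2 * (((pathU f x₁ z n)⁻¹ - (pathU f x₁ z (n + 1))⁻¹)
              * (1 + B)) := by gcongr
          _ = _ := by ring
      simp only [pathW, Finset.sum_range_succ] at ih ⊢
      rw [pathLin, pathWeight]
      linarith
  refine le_trans ?_ ((key n).trans ?_)
  · have := one_le_pathU f x₁ z n
    have : 0 ≤ (pathU f x₁ z n + 8 * B) * ‖pathErr 𝒟 f x₁ z n‖ ^ 2 := by positivity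
    linarith
  · have hu := one_le_pathU f x₁ z n
    have : 0 ≤ (pathU f x₁ z n)⁻¹ := by positivity
    have h3 : 0 ≤ 129 * (1 + B) ^ 3 := by positivity
    nlinarith

/-- Summing the descent inequality along a path. -/
lemma Assumptions.sqrt_pathD_div_le [IsProbabilityMeasure 𝒟] (h : Assumptions 𝒟 f σ β σh)
    {l : ℝ} (hl : 0 < l) (n : ℕ) :
    √(pathD f x₁ z n / pathU f x₁ z n)
      ≤ 1 + (objective 𝒟 f x₁ - ⨅ x, objective 𝒟 f x) + pathW 𝒟 f x₁ z (n + 1) / (2 * l)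
        + (l / 2 + β) * Real.log (pathD f x₁ z n) := by
  have hstep : ∀ k, ‖pathM f x₁ z k‖ ^ 2 / (√(pathD f x₁ z k) * √(pathU f x₁ z k))
      ≤ (objective 𝒟 f (pathX f x₁ z k) - objective 𝒟 f (pathX f x₁ z (k + 1)))
        + (‖pathErr 𝒟 f x₁ z k‖ ^ 2 / pathU f x₁ z k) / (2 * l)
        + (l / 2 + β) * (‖pathM f x₁ z k‖ ^ 2 / pathD f x₁ z k) := fun k => by
    have hD := one_le_pathD f x₁ z k
    have hU := one_le_pathU f x₁ z k
    have h1 := h.objective_sub_le (pathX f x₁ z k)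
      (-((√(pathD f x₁ z k) * √(pathU f x₁ z k))⁻¹ • pathM f x₁ z k))
    have hn := norm_pathX_succ_sub_sq f x₁ z k
    rw [pathX_succ, sub_sub_cancel_left] at hn
    rw [← sub_eq_add_neg, ← pathX_succ, hn] at h1
    have hE : pathErr 𝒟 f x₁ z k = pathM f x₁ z k - meanGrad 𝒟 f (pathX f x₁ z k) := rfl
    have hg : meanGrad 𝒟 f (pathX f x₁ z k) = pathM f x₁ z k - pathErr 𝒟 f x₁ z k := by
      rw [hE, sub_sub_cancel]
    rw [hg, inner_neg_right, inner_smul_right, inner_sub_left, real_inner_self_eq_norm_sq] at h1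
    have hi := real_inner_le_norm (pathErr 𝒟 f x₁ z k) (pathM f x₁ z k)
    have hb : pathD f x₁ z k ≤ pathD f x₁ z k * pathU f x₁ z k := by nlinarith
    have h2 : β * (‖pathM f x₁ z k‖ ^ 2 / (pathD f x₁ z k * pathU f x₁ z k))
        ≤ β * (‖pathM f x₁ z k‖ ^ 2 / pathD f x₁ z k) := by
      have := h.beta_nonneg
      gcongr
    -- Young's inequality splits the step size so that the error receives `1 / u` and the momentum
    -- `1 / D`; `l` remains free and is later taken to be `κ₂`.
    have h3 : (√(pathD f x₁ z k) * √(pathU f x₁ z k))⁻¹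
        * (‖pathErr 𝒟 f x₁ z k‖ * ‖pathM f x₁ z k‖)
        ≤ (‖pathErr 𝒟 f x₁ z k‖ ^ 2 / pathU f x₁ z k) / (2 * l)
          + l / 2 * (‖pathM f x₁ z k‖ ^ 2 / pathD f x₁ z k) := by
      have hd := Real.sq_sqrt (by linarith : 0 ≤ pathD f x₁ z k)
      have hu := Real.sq_sqrt (by linarith : 0 ≤ pathU f x₁ z k)
      have hd0 : 0 < √(pathD f x₁ z k) := Real.sqrt_pos.2 (by linarith)
      have hu0 : 0 < √(pathU f x₁ z k) := Real.sqrt_pos.2 (by linarith)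
      rw [← hd, ← hu, Real.sqrt_sq hd0.le, Real.sqrt_sq hu0.le]
      have := sq_nonneg (‖pathErr 𝒟 f x₁ z k‖ / √(pathU f x₁ z k)
        - l * (‖pathM f x₁ z k‖ / √(pathD f x₁ z k)))
      rw [← sub_nonneg]
      refine le_of_le_of_eq (div_nonneg this (by positivity : 0 ≤ 2 * l)) ?_
      field_simp
      ring
    have hb0 : 0 ≤ (√(pathD f x₁ z k) * √(pathU f x₁ z k))⁻¹ := by positivity
    have h4 := mul_le_mul_of_nonneg_left hi hb0
    rw [div_eq_inv_mul (_ ^ 2) (√_ * √_)]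
    linarith
  have hsum := Finset.sum_le_sum fun k (_ : k ∈ Finset.range (n + 1)) => hstep k
  rw [Finset.sum_add_distrib, Finset.sum_add_distrib, Finset.sum_range_sub', ← Finset.sum_div,
    ← Finset.mul_sum, pathX_zero] at hsum
  have hlog := sum_norm_pathM_sq_div_le f x₁ z n
  have hinf : ⨅ x, objective 𝒟 f x ≤ objective 𝒟 f (pathX f x₁ z (n + 1)) :=
    ciInf_le h.lower_bounded _
  have hc : 0 ≤ l / 2 + β := by linarith [h.beta_nonneg]
  have hmul := mul_le_mul_of_nonneg_left hlog hc
  have hD := one_le_pathD f x₁ z n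
  have hU := one_le_pathU f x₁ z n
  -- Replacing every denominator by the last and largest one turns the sum into `(D - 1) / √(D u)`.
  have hlow : √(pathD f x₁ z n / pathU f x₁ z n) - 1 ≤ ∑ k ∈ Finset.range (n + 1),
      ‖pathM f x₁ z k‖ ^ 2 / (√(pathD f x₁ z k) * √(pathU f x₁ z k)) := by
    have h1 : ∑ k ∈ Finset.range (n + 1), ‖pathM f x₁ z k‖ ^ 2
          / (√(pathD f x₁ z n) * √(pathU f x₁ z n))
        ≤ ∑ k ∈ Finset.range (n + 1), ‖pathM f x₁ z k‖ ^ 2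
          / (√(pathD f x₁ z k) * √(pathU f x₁ z k)) := by
      refine Finset.sum_le_sum fun k hk => ?_
      have hkn : k ≤ n := Nat.lt_succ_iff.1 (Finset.mem_range.1 hk)
      have hd0 : 0 < √(pathD f x₁ z k) := Real.sqrt_pos.2 (by linarith [one_le_pathD f x₁ z k])
      have hu0 : 0 < √(pathU f x₁ z k) := Real.sqrt_pos.2 (by linarith [one_le_pathU f x₁ z k])
      have := pathD_mono f x₁ z hkn
      have := pathU_mono f x₁ z hkn
      gcongr
    refine le_trans ?_ h1
    rw [← Finset.sum_div, sum_norm_pathM_sq]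
    have hd0 : 0 < √(pathD f x₁ z n) := Real.sqrt_pos.2 (by linarith)
    have hd1 : 1 ≤ √(pathD f x₁ z n) := Real.one_le_sqrt.2 hD
    have hu1 : 1 ≤ √(pathU f x₁ z n) := Real.one_le_sqrt.2 hU
    have hu0 : 0 < √(pathU f x₁ z n) := Real.sqrt_pos.2 (by linarith)
    rw [Real.sqrt_div (by linarith), le_div_iff₀ (by positivity)]
    have he : (√(pathD f x₁ z n) / √(pathU f x₁ z n) - 1)
        * (√(pathD f x₁ z n) * √(pathU f x₁ z n))
        = √(pathD f x₁ z n) ^ 2 - √(pathD f x₁ z n) * √(pathU f x₁ z n) := by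
      field_simp
    rw [he, Real.sq_sqrt (by linarith)]
    nlinarith
  rw [pathW]
  linarith

/-- The sum of the squared gradients is controlled by the momenta and the errors. -/
lemma sum_norm_meanGrad_sq_le (n : ℕ) :
    ∑ k ∈ Finset.range (n + 1), ‖meanGrad 𝒟 f (pathX f x₁ z k)‖ ^ 2
      ≤ 2 * pathU f x₁ z n
        * (√(pathD f x₁ z n / pathU f x₁ z n) + √(pathW 𝒟 f x₁ z (n + 1))) ^ 2 := by
  have hD := one_le_pathD f x₁ z n
  have hU := one_le_pathU f x₁ z n
  have hW : 0 ≤ pathW 𝒟 f x₁ z (n + 1) := pathW_nonneg _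
  have h1 : ∑ k ∈ Finset.range (n + 1), ‖meanGrad 𝒟 f (pathX f x₁ z k)‖ ^ 2
      ≤ ∑ k ∈ Finset.range (n + 1), (2 * ‖pathM f x₁ z k‖ ^ 2
        + 2 * (pathU f x₁ z n * (‖pathErr 𝒟 f x₁ z k‖ ^ 2 / pathU f x₁ z k))) := by
    refine Finset.sum_le_sum fun k hk => ?_
    have hkn : k ≤ n := Nat.lt_succ_iff.1 (Finset.mem_range.1 hk)
    have hk1 := one_le_pathU f x₁ z k
    have h2 : ‖meanGrad 𝒟 f (pathX f x₁ z k)‖ ≤ ‖pathM f x₁ z k‖ + ‖pathErr 𝒟 f x₁ z k‖ := by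
      have : meanGrad 𝒟 f (pathX f x₁ z k) = pathM f x₁ z k - pathErr 𝒟 f x₁ z k := by
        rw [pathErr, sub_sub_cancel]
      rw [this]; exact norm_sub_le _ _
    have h3 : ‖pathErr 𝒟 f x₁ z k‖ ^ 2
        ≤ pathU f x₁ z n * (‖pathErr 𝒟 f x₁ z k‖ ^ 2 / pathU f x₁ z k) := by
      rw [mul_div_assoc', le_div_iff₀ (by linarith), mul_comm]
      gcongr
      exact pathU_mono f x₁ z hkn
    have h4 := pow_le_pow_left₀ (norm_nonneg _) h2 2
    nlinarith [sq_nonneg (‖pathM f x₁ z k‖ - ‖pathErr 𝒟 f x₁ z k‖)]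
  rw [Finset.sum_add_distrib, ← Finset.mul_sum, ← Finset.mul_sum, ← Finset.mul_sum,
    sum_norm_pathM_sq] at h1
  have h5 : ∑ k ∈ Finset.range (n + 1), ‖pathErr 𝒟 f x₁ z k‖ ^ 2 / pathU f x₁ z k
      = pathW 𝒟 f x₁ z (n + 1) := rfl
  rw [h5] at h1
  have h6 : pathU f x₁ z n * √(pathD f x₁ z n / pathU f x₁ z n) ^ 2 = pathD f x₁ z n := by
    rw [Real.sq_sqrt (by positivity)]; field_simp
  have h7 := Real.sq_sqrt hW
  have h8 : 0 ≤ pathU f x₁ z n * (√(pathD f x₁ z n / pathU f x₁ z n)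
      * √(pathW 𝒟 f x₁ z (n + 1))) := by positivity
  have h9 : pathU f x₁ z n * √(pathW 𝒟 f x₁ z (n + 1)) ^ 2
      = pathU f x₁ z n * pathW 𝒟 f x₁ z (n + 1) := by rw [h7]
  nlinarith

end PathProblem

/-! ### Almost surely bounded random variables. -/

/-- Measurable and almost surely bounded. -/
def BddMeas {Ω E : Type*} [MeasurableSpace Ω] [NormedAddCommGroup E] [MeasurableSpace E]
    (P : Measure Ω) (X : Ω → E) : Prop :=
  Measurable X ∧ ∃ c : ℝ, ∀ᵐ ω ∂P, ‖X ω‖ ≤ c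

section BddMeas

variable {Ω E : Type*} [MeasurableSpace Ω] [NormedAddCommGroup E] [MeasurableSpace E]
  [BorelSpace E] [SecondCountableTopology E] {P : Measure Ω}
  {X Y : Ω → E} {a b : Ω → ℝ}

omit [BorelSpace E] [SecondCountableTopology E] in
lemma BddMeas.of_le (hX : Measurable X) {c : ℝ} (h : ∀ ω, ‖X ω‖ ≤ c) : BddMeas P X :=
  ⟨hX, c, Filter.Eventually.of_forall h⟩

omit [BorelSpace E] [SecondCountableTopology E] in
lemma BddMeas.mono (hY : BddMeas P a) (hX : Measurable X) (h : ∀ ω, ‖X ω‖ ≤ ‖a ω‖) :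
    BddMeas P X := by
  obtain ⟨-, c, hc⟩ := hY
  exact ⟨hX, c, hc.mono fun ω hω => (h ω).trans hω⟩

lemma BddMeas.add (hX : BddMeas P X) (hY : BddMeas P Y) : BddMeas P (fun ω => X ω + Y ω) := by
  obtain ⟨hX, c, hc⟩ := hX
  obtain ⟨hY, c', hc'⟩ := hY
  refine ⟨hX.add hY, c + c', ?_⟩
  filter_upwards [hc, hc'] with ω h1 h2
  exact (norm_add_le _ _).trans (add_le_add h1 h2)

lemma BddMeas.sub (hX : BddMeas P X) (hY : BddMeas P Y) : BddMeas P (fun ω => X ω - Y ω) := by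
  obtain ⟨hX, c, hc⟩ := hX
  obtain ⟨hY, c', hc'⟩ := hY
  refine ⟨hX.sub hY, c + c', ?_⟩
  filter_upwards [hc, hc'] with ω h1 h2
  exact (norm_sub_le _ _).trans (add_le_add h1 h2)

lemma BddMeas.smul [NormedSpace ℝ E] (ha : BddMeas P a) (hX : BddMeas P X) :
    BddMeas P (fun ω => a ω • X ω) := by
  obtain ⟨ha, c, hc⟩ := ha
  obtain ⟨hX, c', hc'⟩ := hX
  refine ⟨ha.smul hX, c * c', ?_⟩
  filter_upwards [hc, hc'] with ω h1 h2
  rw [norm_smul]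
  exact mul_le_mul h1 h2 (norm_nonneg _) ((norm_nonneg _).trans h1)

lemma BddMeas.inner [InnerProductSpace ℝ E] (hX : BddMeas P X) (hY : BddMeas P Y) :
    BddMeas P (fun ω => inner ℝ (X ω) (Y ω)) := by
  obtain ⟨hX, c, hc⟩ := hX
  obtain ⟨hY, c', hc'⟩ := hY
  refine ⟨hX.inner hY, c * c', ?_⟩
  filter_upwards [hc, hc'] with ω h1 h2
  exact (norm_inner_le_norm _ _).trans (mul_le_mul h1 h2 (norm_nonneg _) ((norm_nonneg _).trans h1))

lemma BddMeas.mul (ha : BddMeas P a) (hb : BddMeas P b) : BddMeas P (fun ω => a ω * b ω) :=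
  ha.smul hb

omit [SecondCountableTopology E] in
lemma BddMeas.norm (hX : BddMeas P X) : BddMeas P (fun ω => ‖X ω‖) := by
  obtain ⟨hX, c, hc⟩ := hX
  exact ⟨hX.norm, c, by simpa using hc⟩

lemma BddMeas.pow (ha : BddMeas P a) (n : ℕ) : BddMeas P (fun ω => a ω ^ n) := by
  obtain ⟨ha, c, hc⟩ := ha
  refine ⟨ha.pow_const n, c ^ n, ?_⟩
  filter_upwards [hc] with ω h1
  rw [norm_pow]
  exact pow_le_pow_left₀ (norm_nonneg _) h1 n

omit [BorelSpace E] [SecondCountableTopology E] in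
lemma BddMeas.const (x : E) : BddMeas P (fun _ => x) := .of_le measurable_const fun _ => le_rfl

lemma BddMeas.sum {ι : Type*} (s : Finset ι) {g : ι → Ω → ℝ} (h : ∀ i, BddMeas P (g i)) :
    BddMeas P (fun ω => ∑ i ∈ s, g i ω) := by
  classical
  induction s using Finset.induction_on with
  | empty => simpa using BddMeas.const (0 : ℝ)
  | insert i s hi ih => simpa only [Finset.sum_insert hi] using (h i).add ih

lemma BddMeas.integrable [IsFiniteMeasure P] (hX : BddMeas P X) : Integrable X P := by
  obtain ⟨hX, c, hc⟩ := hX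
  exact Integrable.of_bound hX.aestronglyMeasurable c hc

lemma BddMeas.log (ha : BddMeas P a) (h1 : ∀ ω, 1 ≤ a ω) :
    BddMeas P (fun ω => Real.log (a ω)) :=
  ha.mono ha.1.log fun ω => by
    rw [Real.norm_of_nonneg (Real.log_nonneg (h1 ω)), Real.norm_of_nonneg (by linarith [h1 ω])]
    exact Real.log_le_self (by linarith [h1 ω])

lemma BddMeas.sqrt (ha : BddMeas P a) : BddMeas P (fun ω => √(a ω)) := by
  obtain ⟨hm, c, hc⟩ := ha
  refine ⟨hm.sqrt, √c, hc.mono fun ω hω => ?_⟩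
  rw [Real.norm_of_nonneg (Real.sqrt_nonneg _)]
  exact Real.sqrt_le_sqrt ((le_abs_self _).trans hω)

end BddMeas

/-! ### Dependence of the run on the samples. -/

section Measurability

variable {d : ℕ} {Ξ Ω : Type*}
  {f : EuclideanSpace ℝ (Fin d) → Ξ → ℝ} (x₁ : EuclideanSpace ℝ (Fin d))

lemma pathU_succ (z : ℕ → Ξ) (k : ℕ) : pathU f x₁ z (k + 1)
    = (pathU f x₁ z k ^ 3 + ‖pathDiff f x₁ z k‖ ^ 2) ^ (1 / 3 : ℝ) := by
  rw [← pathU_succ_cube, ← Real.rpow_natCast, ← Real.rpow_mul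
    (by linarith [one_le_pathU f x₁ z (k + 1)])]
  norm_num

lemma norm_pathX_sub_le (z : ℕ → Ξ) (k : ℕ) : ‖pathX f x₁ z k - x₁‖ ≤ k := by
  induction k with
  | zero => simp [pathX_zero]
  | succ k ih =>
    have h1 := norm_pathX_succ_sub_le f x₁ z k
    have h2 := norm_sub_le_norm_sub_add_norm_sub (pathX f x₁ z (k + 1)) (pathX f x₁ z k) x₁
    push_cast
    linarith

variable [MeasurableSpace Ξ]

lemma measurable_path [MeasurableSpace Ω]
    (hf : Measurable (fun y : EuclideanSpace ℝ (Fin d) × Ξ => sampleGrad f y.1 y.2))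
    (ξ : ℕ → Ω → Ξ) (k : ℕ) (h : ∀ i ≤ k, Measurable (ξ i)) :
    Measurable (fun ω => pathX f x₁ (fun i => ξ i ω) k)
    ∧ Measurable (fun ω => pathM f x₁ (fun i => ξ i ω) k)
    ∧ Measurable (fun ω => pathU f x₁ (fun i => ξ i ω) k)
    ∧ Measurable (fun ω => pathD f x₁ (fun i => ξ i ω) k) := by
  induction k with
  | zero =>
    have h1 : Measurable (fun ω => pathM f x₁ (fun i => ξ i ω) 0) :=
      hf.comp (measurable_const.prodMk (h 0 le_rfl))
    refine ⟨measurable_const, h1, ?_, ?_⟩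
    · simp only [pathU_zero]; exact measurable_const
    · simp only [pathD_zero]; exact (h1.norm.pow_const 2).const_add 1
  | succ k ih =>
    obtain ⟨hX, hM, hU, hD⟩ := ih fun i hi => h i (hi.trans k.le_succ)
    have hX' : Measurable (fun ω => pathX f x₁ (fun i => ξ i ω) (k + 1)) := by
      simp only [pathX_succ]
      exact hX.sub ((hD.sqrt.mul hU.sqrt).inv.smul hM)
    have hg : ∀ j ≤ k + 1, Measurable (fun ω => sampleGrad f (pathX f x₁ (fun i => ξ i ω) k) (ξ j ω)) :=
      fun j hj => hf.comp (hX.prodMk (h j hj))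
    have hU' : Measurable (fun ω => pathU f x₁ (fun i => ξ i ω) (k + 1)) := by
      simp only [pathU_succ, pathDiff]
      exact ((hU.pow_const 3).add (((hg k k.le_succ).sub (hg (k + 1) le_rfl)).norm.pow_const 2)).pow_const _
    have hM' : Measurable (fun ω => pathM f x₁ (fun i => ξ i ω) (k + 1)) := by
      simp only [pathM_succ]
      exact (hf.comp (hX'.prodMk (h (k + 1) le_rfl))).add
        (((hU'.pow_const 2).inv.const_sub 1).smul (hM.sub (hg (k + 1) le_rfl)))
    refine ⟨hX', hM', hU', ?_⟩
    simp only [pathD_succ]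
    exact hD.add (hM'.norm.pow_const 2)

/-- The iterate uses one sample fewer than the other quantities with the same index: the inequality
`i < k` is strict, so `ξ k` is still fresh at `x_k`. -/
lemma measurable_pathX [MeasurableSpace Ω]
    (hf : Measurable (fun y : EuclideanSpace ℝ (Fin d) × Ξ => sampleGrad f y.1 y.2))
    (ξ : ℕ → Ω → Ξ) (k : ℕ) (h : ∀ i < k, Measurable (ξ i)) :
    Measurable (fun ω => pathX f x₁ (fun i => ξ i ω) k) := by
  cases k with
  | zero => exact measurable_const
  | succ k =>
    obtain ⟨hX, hM, hU, hD⟩ := measurable_path x₁ hf ξ k fun i hi => h i (Nat.lt_succ_of_le hi)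
    simp only [pathX_succ]
    exact hX.sub ((hD.sqrt.mul hU.sqrt).inv.smul hM)

/-- The `σ`-algebra generated by the first `k` samples. -/
@[reducible]
def pastSigma (ξ : ℕ → Ω → Ξ) (k : ℕ) : MeasurableSpace Ω :=
  ⨆ i ∈ Set.Iio k, MeasurableSpace.comap (ξ i) inferInstance

lemma measurable_pastSigma (ξ : ℕ → Ω → Ξ) {i k : ℕ} (h : i < k) :
    Measurable[pastSigma ξ k] (ξ i) :=
  measurable_iff_comap_le.2 (le_iSup₂_of_le i h le_rfl)

variable [MeasurableSpace Ω] {𝒟 : Measure Ξ} {P : Measure Ω} {T : ℕ} {ξ : ℕ → Ω → Ξ} {τ : Ω → ℕ}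

lemma IsRandomness.pastSigma_le (hR : IsRandomness 𝒟 P T ξ τ) (k : ℕ) :
    pastSigma ξ k ≤ ‹MeasurableSpace Ω› :=
  iSup₂_le fun i _ => (hR.measurable_sample i).comap_le

lemma IsRandomness.indepFun_past (hR : IsRandomness 𝒟 P T ξ τ) {𝒳 : Type*} [MeasurableSpace 𝒳]
    {X : Ω → 𝒳} {k j : ℕ} (hX : Measurable[pastSigma ξ k] X) (hj : k ≤ j) :
    IndepFun X (ξ j) P := by
  have h1 : Indep (⨆ i ∈ Set.Iio k, MeasurableSpace.comap (ξ i) inferInstance)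
      (⨆ i ∈ ({j} : Set ℕ), MeasurableSpace.comap (ξ i) inferInstance) P :=
    indep_iSup_of_disjoint (fun i => (hR.measurable_sample i).comap_le) hR.indep_sample.iIndep
      (by simpa using hj)
  have h2 : Indep (MeasurableSpace.comap X inferInstance)
      (MeasurableSpace.comap (ξ j) inferInstance) P := by
    simp only [Set.mem_singleton_iff, iSup_iSup_eq_left] at h1
    exact indep_of_indep_of_le_left h1 hX.comap_le
  exact h2

end Measurability

/-! ### Boundedness, hence integrability, of all quantities. -/

section Integrability

variable {d : ℕ} {Ξ Ω : Type*} [MeasurableSpace Ξ] [MeasurableSpace Ω] {𝒟 : Measure Ξ}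
  {P : Measure Ω}
  {f : EuclideanSpace ℝ (Fin d) → Ξ → ℝ} {σ β σh : ℝ} {x₁ : EuclideanSpace ℝ (Fin d)}
  {T : ℕ} {ξ : ℕ → Ω → Ξ} {τ : Ω → ℕ}

lemma measurable_pathX' (h : Assumptions 𝒟 f σ β σh) (hR : IsRandomness 𝒟 P T ξ τ) (k : ℕ) :
    Measurable (fun ω => pathX f x₁ (fun i => ξ i ω) k) :=
  measurable_pathX x₁ h.measurable_grad ξ k fun i _ => hR.measurable_sample i

lemma measurable_pathU (h : Assumptions 𝒟 f σ β σh) (hR : IsRandomness 𝒟 P T ξ τ) (k : ℕ) :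
    Measurable (fun ω => pathU f x₁ (fun i => ξ i ω) k) :=
  (measurable_path x₁ h.measurable_grad ξ k fun i _ => hR.measurable_sample i).2.2.1

lemma bddMeas_inv_pathU (h : Assumptions 𝒟 f σ β σh) (hR : IsRandomness 𝒟 P T ξ τ) (k : ℕ) :
    BddMeas P (fun ω => (pathU f x₁ (fun i => ξ i ω) k)⁻¹) :=
  .of_le (measurable_pathU h hR k).inv (c := 1) fun ω => by
    have := one_le_pathU f x₁ (fun i => ξ i ω) k
    rw [norm_inv, Real.norm_of_nonneg (by linarith)]
    exact inv_le_one_of_one_le₀ this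

lemma bddMeas_inv_pathU_sq (h : Assumptions 𝒟 f σ β σh) (hR : IsRandomness 𝒟 P T ξ τ) (k : ℕ) :
    BddMeas P (fun ω => (pathU f x₁ (fun i => ξ i ω) k ^ 2)⁻¹) := by
  simp only [← inv_pow]
  exact (bddMeas_inv_pathU h hR k).pow 2

variable [IsProbabilityMeasure 𝒟]

lemma bddMeas_meanGrad_pathX (h : Assumptions 𝒟 f σ β σh) (hR : IsRandomness 𝒟 P T ξ τ) (k : ℕ) :
    BddMeas P (fun ω => meanGrad 𝒟 f (pathX f x₁ (fun i => ξ i ω) k)) := by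
  refine .of_le (h.measurable_meanGrad.comp (measurable_pathX' h hR k))
    (c := β * k + ‖meanGrad 𝒟 f x₁‖) fun ω => ?_
  have h1 := h.norm_meanGrad_sub_le (pathX f x₁ (fun i => ξ i ω) k) x₁
  have h2 := mul_le_mul_of_nonneg_left (norm_pathX_sub_le (f := f) x₁ (fun i => ξ i ω) k)
    h.beta_nonneg
  have h3 := norm_le_norm_sub_add (meanGrad 𝒟 f (pathX f x₁ (fun i => ξ i ω) k))
    (meanGrad 𝒟 f x₁)
  linarith

variable [IsProbabilityMeasure P]

/-- The null set in the noise bound depends on the point; since `x_k` is independent of `ξ j` for `j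
≥ k`, Fubini allows the random point to be inserted. -/
lemma ae_norm_pathNoise_le (h : Assumptions 𝒟 f σ β σh) (hR : IsRandomness 𝒟 P T ξ τ) {k j : ℕ}
    (hj : k ≤ j) : ∀ᵐ ω ∂P, ‖pathNoise 𝒟 f x₁ (fun i => ξ i ω) k j‖ ≤ 2 * σh := by
  have hX : Measurable[pastSigma ξ k] (fun ω => pathX f x₁ (fun i => ξ i ω) k) :=
    @measurable_pathX d Ξ Ω f x₁ _ (pastSigma ξ k) h.measurable_grad ξ k
      fun i hi => measurable_pastSigma ξ hi
  refine ae_fresh (p := fun y => ‖sampleGrad f y.1 y.2 - meanGrad 𝒟 f y.1‖ ≤ 2 * σh)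
    (hX.mono (hR.pastSigma_le k) le_rfl) (hR.measurable_sample j) (hR.indepFun_past hX hj)
    (hR.law_sample j) ?_ h.ae_norm_sub_meanGrad_le
  exact measurableSet_le
    (h.measurable_grad.sub (h.measurable_meanGrad.comp measurable_fst)).norm measurable_const

lemma ae_noiseBound (h : Assumptions 𝒟 f σ β σh) (hR : IsRandomness 𝒟 P T ξ τ) :
    ∀ᵐ ω ∂P, NoiseBound 𝒟 f x₁ σh (fun i => ξ i ω) :=
  ae_all_iff.2 fun k => (ae_norm_pathNoise_le h hR le_rfl).and (ae_norm_pathNoise_le h hR k.le_succ)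

lemma bddMeas_pathNoise (h : Assumptions 𝒟 f σ β σh) (hR : IsRandomness 𝒟 P T ξ τ) {k j : ℕ}
    (hj : k ≤ j) : BddMeas P (fun ω => pathNoise 𝒟 f x₁ (fun i => ξ i ω) k j) :=
  ⟨(h.measurable_grad.comp ((measurable_pathX' h hR k).prodMk (hR.measurable_sample j))).sub
    (h.measurable_meanGrad.comp (measurable_pathX' h hR k)), _, ae_norm_pathNoise_le h hR hj⟩

lemma bddMeas_pathDiff (h : Assumptions 𝒟 f σ β σh) (hR : IsRandomness 𝒟 P T ξ τ) (k : ℕ) :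
    BddMeas P (fun ω => pathDiff f x₁ (fun i => ξ i ω) k) := by
  simp only [pathDiff_eq (𝒟 := 𝒟)]
  exact (bddMeas_pathNoise h hR le_rfl).sub (bddMeas_pathNoise h hR k.le_succ)

lemma bddMeas_pathZ (h : Assumptions 𝒟 f σ β σh) (hR : IsRandomness 𝒟 P T ξ τ) (k : ℕ) :
    BddMeas P (fun ω => pathZ 𝒟 f x₁ (fun i => ξ i ω) k) := by
  simp only [pathZ_eq]
  exact (bddMeas_pathNoise h hR le_rfl).sub (bddMeas_pathNoise h hR k.le_succ)

lemma bddMeas_pathU_cube (h : Assumptions 𝒟 f σ β σh) (hR : IsRandomness 𝒟 P T ξ τ) (k : ℕ) :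
    BddMeas P (fun ω => pathU f x₁ (fun i => ξ i ω) k ^ 3) := by
  induction k with
  | zero => simpa only [pathU_zero] using BddMeas.const _
  | succ k ih =>
    simp only [pathU_succ_cube]
    exact ih.add ((bddMeas_pathDiff h hR k).norm.pow 2)

lemma bddMeas_pathU (h : Assumptions 𝒟 f σ β σh) (hR : IsRandomness 𝒟 P T ξ τ) (k : ℕ) :
    BddMeas P (fun ω => pathU f x₁ (fun i => ξ i ω) k) := by
  refine (bddMeas_pathU_cube h hR (x₁ := x₁) k).mono (measurable_pathU h hR k) fun ω => ?_
  have := one_le_pathU f x₁ (fun i => ξ i ω) k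
  rw [norm_pow, Real.norm_of_nonneg (by linarith)]
  exact le_self_pow₀ this three_ne_zero

lemma bddMeas_pathErr (h : Assumptions 𝒟 f σ β σh) (hR : IsRandomness 𝒟 P T ξ τ) (k : ℕ) :
    BddMeas P (fun ω => pathErr 𝒟 f x₁ (fun i => ξ i ω) k) := by
  induction k with
  | zero => simp only [pathErr_zero]; exact bddMeas_pathNoise h hR le_rfl
  | succ k ih =>
    simp only [pathErr_succ]
    have hr := bddMeas_inv_pathU_sq h hR (x₁ := x₁) (k + 1)
    exact (((BddMeas.const 1).sub hr).smul (ih.add (bddMeas_pathZ h hR k))).add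
      (hr.smul (bddMeas_pathNoise h hR le_rfl))

/-- The sampled gradients have no direct bound, so the momentum is bounded through its error and the
Lipschitz mean gradient at a bounded iterate. -/
lemma bddMeas_pathM (h : Assumptions 𝒟 f σ β σh) (hR : IsRandomness 𝒟 P T ξ τ) (k : ℕ) :
    BddMeas P (fun ω => pathM f x₁ (fun i => ξ i ω) k) := by
  have := (bddMeas_pathErr h hR (x₁ := x₁) k).add (bddMeas_meanGrad_pathX h hR (x₁ := x₁) k)
  simpa only [pathErr, sub_add_cancel] using this

lemma bddMeas_pathD (h : Assumptions 𝒟 f σ β σh) (hR : IsRandomness 𝒟 P T ξ τ) (k : ℕ) :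
    BddMeas P (fun ω => pathD f x₁ (fun i => ξ i ω) k) := by
  induction k with
  | zero =>
    simp only [pathD_zero]
    exact (BddMeas.const 1).add ((bddMeas_pathM h hR 0).norm.pow 2)
  | succ k ih =>
    simp only [pathD_succ]
    exact ih.add ((bddMeas_pathM h hR (k + 1)).norm.pow 2)

lemma bddMeas_norm_pathM_sq_div (h : Assumptions 𝒟 f σ β σh) (hR : IsRandomness 𝒟 P T ξ τ)
    (k : ℕ) : BddMeas P
      (fun ω => ‖pathM f x₁ (fun i => ξ i ω) k‖ ^ 2 / pathD f x₁ (fun i => ξ i ω) k) := by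
  refine .of_le (((bddMeas_pathM h hR k).norm.pow 2).1.div (bddMeas_pathD h hR k).1) (c := 1)
    fun ω => ?_
  have := one_le_pathD f x₁ (fun i => ξ i ω) k
  rw [Real.norm_of_nonneg (by positivity)]
  exact div_le_one_of_le₀ (norm_pathM_sq_le f x₁ _ k) (by linarith)

lemma bddMeas_pathW (h : Assumptions 𝒟 f σ β σh) (hR : IsRandomness 𝒟 P T ξ τ) (n : ℕ) :
    BddMeas P (fun ω => pathW 𝒟 f x₁ (fun i => ξ i ω) n) :=
  BddMeas.sum _ fun k => ((bddMeas_pathErr h hR k).norm.pow 2).mul (bddMeas_inv_pathU h hR k)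

lemma bddMeas_pathWeight (h : Assumptions 𝒟 f σ β σh) (hR : IsRandomness 𝒟 P T ξ τ) (B : ℝ)
    (k : ℕ) : BddMeas P (fun ω => pathWeight f x₁ B (fun i => ξ i ω) k) :=
  ((bddMeas_pathU h hR k).add (BddMeas.const (8 * B))).mul ((bddMeas_inv_pathU_sq h hR k).pow 2)

end Integrability

/-! ### Expectations of the terms of the error recursion. -/

section Expectation

variable {d : ℕ} {Ξ Ω : Type*} [MeasurableSpace Ξ] {𝒟 : Measure Ξ}
  {f : EuclideanSpace ℝ (Fin d) → Ξ → ℝ} {σ β σh : ℝ} {x₁ : EuclideanSpace ℝ (Fin d)}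

lemma measurable_pastSigma_pathX (h : Assumptions 𝒟 f σ β σh) (ξ : ℕ → Ω → Ξ) {k j : ℕ}
    (hk : k ≤ j) : Measurable[pastSigma ξ j] (fun ω => pathX f x₁ (fun i => ξ i ω) k) :=
  @measurable_pathX d Ξ Ω f x₁ _ (pastSigma ξ j) h.measurable_grad ξ k
    fun _ hi => measurable_pastSigma ξ (hi.trans_le hk)

lemma measurable_pastSigma_pathU (h : Assumptions 𝒟 f σ β σh) (ξ : ℕ → Ω → Ξ) (k : ℕ) :
    Measurable[pastSigma ξ (k + 1)] (fun ω => pathU f x₁ (fun i => ξ i ω) k) :=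
  (@measurable_path d Ξ Ω f x₁ _ (pastSigma ξ (k + 1)) h.measurable_grad ξ k
    fun _ hi => measurable_pastSigma ξ (Nat.lt_succ_of_le hi)).2.2.1

lemma measurable_pastSigma_pathErr [IsProbabilityMeasure 𝒟] (h : Assumptions 𝒟 f σ β σh)
    (ξ : ℕ → Ω → Ξ) (k : ℕ) :
    Measurable[pastSigma ξ (k + 1)] (fun ω => pathErr 𝒟 f x₁ (fun i => ξ i ω) k) := by
  have hM : Measurable[pastSigma ξ (k + 1)] (fun ω => pathM f x₁ (fun i => ξ i ω) k) :=
    (@measurable_path d Ξ Ω f x₁ _ (pastSigma ξ (k + 1)) h.measurable_grad ξ k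
      fun _ hi => measurable_pastSigma ξ (Nat.lt_succ_of_le hi)).2.1
  have hG : Measurable[pastSigma ξ (k + 1)]
      (fun ω => meanGrad 𝒟 f (pathX f x₁ (fun i => ξ i ω) k)) :=
    h.measurable_meanGrad.comp (measurable_pastSigma_pathX h ξ k.le_succ)
  exact hM.sub hG

lemma Assumptions.measurable_noise [IsProbabilityMeasure 𝒟] (h : Assumptions 𝒟 f σ β σh)
    {𝒳 : Type*} [MeasurableSpace 𝒳] {X : 𝒳 → EuclideanSpace ℝ (Fin d)} {Z : 𝒳 → Ξ}
    (hX : Measurable X) (hZ : Measurable Z) :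
    Measurable (fun y => sampleGrad f (X y) (Z y) - meanGrad 𝒟 f (X y)) :=
  (h.measurable_grad.comp (hX.prodMk hZ)).sub (h.measurable_meanGrad.comp hX)

variable [MeasurableSpace Ω] {P : Measure Ω} {T : ℕ} {ξ : ℕ → Ω → Ξ} {τ : Ω → ℕ}
  [IsProbabilityMeasure 𝒟] [IsProbabilityMeasure P]

lemma integral_norm_pathNoise_sq_le (h : Assumptions 𝒟 f σ β σh) (hR : IsRandomness 𝒟 P T ξ τ)
    {k j : ℕ} (hj : k ≤ j) :
    ∫ ω, ‖pathNoise 𝒟 f x₁ (fun i => ξ i ω) k j‖ ^ 2 ∂P ≤ σ ^ 2 := by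
  have hX := measurable_pastSigma_pathX (x₁ := x₁) h ξ (le_refl k)
  have := integral_fresh_le (hX.mono (hR.pastSigma_le k) le_rfl) (hR.measurable_sample j)
    (hR.indepFun_past hX hj) (hR.law_sample j)
    (h := fun y => ‖sampleGrad f y.1 y.2 - meanGrad 𝒟 f y.1‖ ^ 2)
    ((h.measurable_noise measurable_fst measurable_snd).norm.pow_const 2)
    ((bddMeas_pathNoise h hR hj).norm.pow 2).integrable (integrable_const (σ ^ 2))
    (Filter.Eventually.of_forall fun ω => h.variance_le _)
  simpa [pathNoise] using this

/-- Each increment of the cube is the squared difference of two noises at the same iterate, both of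
variance at most `σ²`. -/
lemma integral_pathU_cube_le (h : Assumptions 𝒟 f σ β σh) (hR : IsRandomness 𝒟 P T ξ τ) (k : ℕ) :
    ∫ ω, pathU f x₁ (fun i => ξ i ω) k ^ 3 ∂P ≤ 1 + 4 * σ ^ 2 * k := by
  induction k with
  | zero => simp [pathU_zero]
  | succ k ih =>
    simp only [pathU_succ_cube]
    have h1 := ((bddMeas_pathNoise h hR (x₁ := x₁) (le_refl k)).norm.pow 2).integrable
    have h2 := ((bddMeas_pathNoise h hR (x₁ := x₁) k.le_succ).norm.pow 2).integrable
    have hd := ((bddMeas_pathDiff h hR (x₁ := x₁) k).norm.pow 2).integrable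
    rw [integral_add (bddMeas_pathU_cube h hR k).integrable hd]
    have h3 : ∫ ω, ‖pathDiff f x₁ (fun i => ξ i ω) k‖ ^ 2 ∂P
        ≤ ∫ ω, (2 * ‖pathNoise 𝒟 f x₁ (fun i => ξ i ω) k k‖ ^ 2
          + 2 * ‖pathNoise 𝒟 f x₁ (fun i => ξ i ω) k (k + 1)‖ ^ 2) ∂P := by
      refine integral_mono hd ((h1.const_mul 2).add (h2.const_mul 2)) fun ω => ?_
      simp only [pathDiff_eq (𝒟 := 𝒟)]
      have := pow_le_pow_left₀ (norm_nonneg _) (norm_sub_le (pathNoise 𝒟 f x₁ (fun i => ξ i ω) k k)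
        (pathNoise 𝒟 f x₁ (fun i => ξ i ω) k (k + 1))) 2
      nlinarith [sq_nonneg (‖pathNoise 𝒟 f x₁ (fun i => ξ i ω) k k‖
        - ‖pathNoise 𝒟 f x₁ (fun i => ξ i ω) k (k + 1)‖)]
    rw [integral_add (h1.const_mul 2) (h2.const_mul 2), integral_const_mul,
      integral_const_mul] at h3
    have h4 := integral_norm_pathNoise_sq_le (x₁ := x₁) h hR (le_refl k)
    have h5 := integral_norm_pathNoise_sq_le (x₁ := x₁) h hR k.le_succ
    push_cast
    linarith

lemma bddMeas_pathLin (h : Assumptions 𝒟 f σ β σh) (hR : IsRandomness 𝒟 P T ξ τ) (B : ℝ)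
    (k : ℕ) : BddMeas P (fun ω => pathLin 𝒟 f x₁ B (fun i => ξ i ω) k) := by
  have hu := bddMeas_pathU h hR (x₁ := x₁) k
  have hr := bddMeas_inv_pathU_sq h hR (x₁ := x₁) k
  have hc := (BddMeas.const (P := P) 1).sub hr
  have hw := hu.add (BddMeas.const (8 * B))
  have he := bddMeas_pathErr h hR (x₁ := x₁) k
  exact (((BddMeas.const 2).mul (hw.mul (hc.pow 2))).mul (he.inner (bddMeas_pathZ h hR k))).add
    (((BddMeas.const 2).mul (hw.mul (hr.mul hc))).mul
      (he.inner (bddMeas_pathNoise h hR le_rfl)))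

/-- The linear term of the error recursion is centred. -/
lemma integral_pathLin (h : Assumptions 𝒟 f σ β σh) (hR : IsRandomness 𝒟 P T ξ τ) (B : ℝ)
    (k : ℕ) : ∫ ω, pathLin 𝒟 f x₁ B (fun i => ξ i ω) k ∂P = 0 := by
  let X : Ω → ℝ × EuclideanSpace ℝ (Fin d) × EuclideanSpace ℝ (Fin d) × EuclideanSpace ℝ (Fin d) :=
    fun ω => (pathU f x₁ (fun i => ξ i ω) k, pathErr 𝒟 f x₁ (fun i => ξ i ω) k,
      pathX f x₁ (fun i => ξ i ω) k, pathX f x₁ (fun i => ξ i ω) (k + 1))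
  -- Here it matters that the coefficients contain `u_k` and not `u_{k+1}`: everything in `X`,
  -- including `x_{k+1}`, is determined by the samples `0, …, k`.
  have hX : Measurable[pastSigma ξ (k + 1)] X :=
    (measurable_pastSigma_pathU h ξ k).prodMk ((measurable_pastSigma_pathErr h ξ k).prodMk
      ((measurable_pastSigma_pathX h ξ k.le_succ).prodMk (measurable_pastSigma_pathX h ξ le_rfl)))
  let g : (ℝ × EuclideanSpace ℝ (Fin d) × EuclideanSpace ℝ (Fin d) × EuclideanSpace ℝ (Fin d)) × Ξ
      → ℝ := fun y =>
    2 * ((y.1.1 + 8 * B) * (1 - (y.1.1 ^ 2)⁻¹) ^ 2)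
      * inner ℝ y.1.2.1 (gradNoiseDiff 𝒟 f y.1.2.2.1 y.1.2.2.2 y.2)
    + 2 * ((y.1.1 + 8 * B) * ((y.1.1 ^ 2)⁻¹ * (1 - (y.1.1 ^ 2)⁻¹)))
      * inner ℝ y.1.2.1 (sampleGrad f y.1.2.2.2 y.2 - meanGrad 𝒟 f y.1.2.2.2)
  have hx : Measurable (fun y : (ℝ × EuclideanSpace ℝ (Fin d) × EuclideanSpace ℝ (Fin d)
      × EuclideanSpace ℝ (Fin d)) × Ξ => y.1.2.2.1) := by fun_prop
  have hy : Measurable (fun y : (ℝ × EuclideanSpace ℝ (Fin d) × EuclideanSpace ℝ (Fin d)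
      × EuclideanSpace ℝ (Fin d)) × Ξ => y.1.2.2.2) := by fun_prop
  have hn1 := h.measurable_noise hx measurable_snd
  have hn2 := h.measurable_noise hy measurable_snd
  have he : Measurable (fun y : (ℝ × EuclideanSpace ℝ (Fin d) × EuclideanSpace ℝ (Fin d)
      × EuclideanSpace ℝ (Fin d)) × Ξ => y.1.2.1) := by fun_prop
  have hg : Measurable g := by
    refine Measurable.add (Measurable.mul (by fun_prop) (he.inner (hn2.sub hn1)))
      (Measurable.mul (by fun_prop) (he.inner hn2))
  have key := integral_fresh (hX.mono (hR.pastSigma_le _) le_rfl) (hR.measurable_sample (k + 1))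
    (hR.indepFun_past hX le_rfl) (hR.law_sample (k + 1)) hg (bddMeas_pathLin h hR B k).integrable
  refine key.trans ?_
  rw [← integral_zero Ω ℝ (μ := P)]
  congr 1
  ext ω
  generalize X ω = y
  have hi : ∀ v x, Integrable (fun z => inner ℝ v (sampleGrad f x z - meanGrad 𝒟 f x)) 𝒟 :=
    fun v x => ((h.integrable_grad x).sub (integrable_const _)).const_inner v
  have hi' : ∀ v x x', Integrable (fun z => inner ℝ v (gradNoiseDiff 𝒟 f x x' z)) 𝒟 :=
    fun v x x' => ((((h.integrable_grad x').sub (integrable_const _))).sub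
      ((h.integrable_grad x).sub (integrable_const _))).const_inner v
  simp only [g]
  rw [integral_add ((hi' _ _ _).const_mul _) ((hi _ _).const_mul _), integral_const_mul,
    integral_const_mul, h.integral_inner_gradNoiseDiff, h.integral_inner_noise]
  simp

/-- Given the samples up to `k`, smoothness bounds the second moment of `Z` by the squared step,
whose denominator `D u` cancels the weight and leaves a summand of a logarithmic series. -/
lemma integral_pathU_mul_norm_pathZ_sq_le (h : Assumptions 𝒟 f σ β σh)
    (hR : IsRandomness 𝒟 P T ξ τ) (k : ℕ) :
    ∫ ω, pathU f x₁ (fun i => ξ i ω) k * ‖pathZ 𝒟 f x₁ (fun i => ξ i ω) k‖ ^ 2 ∂P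
      ≤ 4 * β ^ 2 * ∫ ω, ‖pathM f x₁ (fun i => ξ i ω) k‖ ^ 2
        / pathD f x₁ (fun i => ξ i ω) k ∂P := by
  let X : Ω → ℝ × EuclideanSpace ℝ (Fin d) × EuclideanSpace ℝ (Fin d) :=
    fun ω => (pathU f x₁ (fun i => ξ i ω) k,
      pathX f x₁ (fun i => ξ i ω) k, pathX f x₁ (fun i => ξ i ω) (k + 1))
  have hX : Measurable[pastSigma ξ (k + 1)] X :=
    (measurable_pastSigma_pathU h ξ k).prodMk
      ((measurable_pastSigma_pathX h ξ k.le_succ).prodMk (measurable_pastSigma_pathX h ξ le_rfl))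
  let g : (ℝ × EuclideanSpace ℝ (Fin d) × EuclideanSpace ℝ (Fin d)) × Ξ → ℝ := fun y =>
    y.1.1 * ‖gradNoiseDiff 𝒟 f y.1.2.1 y.1.2.2 y.2‖ ^ 2
  have hx : Measurable (fun y : (ℝ × EuclideanSpace ℝ (Fin d)
      × EuclideanSpace ℝ (Fin d)) × Ξ => y.1.2.1) := by fun_prop
  have hy : Measurable (fun y : (ℝ × EuclideanSpace ℝ (Fin d)
      × EuclideanSpace ℝ (Fin d)) × Ξ => y.1.2.2) := by fun_prop
  have hg : Measurable g := Measurable.mul (by fun_prop)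
    (((h.measurable_noise hy measurable_snd).sub
      (h.measurable_noise hx measurable_snd)).norm.pow_const 2)
  rw [← integral_const_mul]
  refine integral_fresh_le (hX.mono (hR.pastSigma_le _) le_rfl) (hR.measurable_sample (k + 1))
    (hR.indepFun_past hX le_rfl) (hR.law_sample (k + 1)) hg
    ((bddMeas_pathU h hR k).mul ((bddMeas_pathZ h hR k).norm.pow 2)).integrable
    ((bddMeas_norm_pathM_sq_div h hR k).integrable.const_mul _)
    (Filter.Eventually.of_forall fun ω => ?_)
  simp only [g, X]
  rw [integral_const_mul]
  have h1 := h.integral_norm_gradNoiseDiff_sq_le (pathX f x₁ (fun i => ξ i ω) k)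
    (pathX f x₁ (fun i => ξ i ω) (k + 1))
  have hu := one_le_pathU f x₁ (fun i => ξ i ω) k
  have hD := one_le_pathD f x₁ (fun i => ξ i ω) k
  rw [norm_pathX_succ_sub_sq] at h1
  calc _ ≤ pathU f x₁ (fun i => ξ i ω) k * (4 * β ^ 2 * (‖pathM f x₁ (fun i => ξ i ω) k‖ ^ 2
        / (pathD f x₁ (fun i => ξ i ω) k * pathU f x₁ (fun i => ξ i ω) k))) := by gcongr
    _ = _ := by field_simp

/-- The variance noise is dominated by the next gradient difference. -/
lemma integral_pathWeight_mul_norm_pathNoise_sq_le (h : Assumptions 𝒟 f σ β σh)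
    (hR : IsRandomness 𝒟 P T ξ τ) {B : ℝ} (hB : 0 ≤ B) (k : ℕ) :
    ∫ ω, pathWeight f x₁ B (fun i => ξ i ω) k * ‖pathNoise 𝒟 f x₁ (fun i => ξ i ω) k k‖ ^ 2 ∂P
      ≤ ∫ ω, pathWeight f x₁ B (fun i => ξ i ω) k * ‖pathDiff f x₁ (fun i => ξ i ω) k‖ ^ 2 ∂P := by
  -- The sample `ξ k` counts as past here. Averaging over `ξ (k + 1)` alone leaves the weight fixed,
  -- so Jensen's inequality applies under it.
  let X : Ω → ℝ × EuclideanSpace ℝ (Fin d) × Ξ :=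
    fun ω => (pathU f x₁ (fun i => ξ i ω) k, pathX f x₁ (fun i => ξ i ω) k, ξ k ω)
  have hX : Measurable[pastSigma ξ (k + 1)] X :=
    (measurable_pastSigma_pathU h ξ k).prodMk
      ((measurable_pastSigma_pathX h ξ k.le_succ).prodMk (measurable_pastSigma ξ k.lt_succ_self))
  let g : (ℝ × EuclideanSpace ℝ (Fin d) × Ξ) × Ξ → ℝ := fun y =>
    (y.1.1 + 8 * B) * ((y.1.1 ^ 2)⁻¹) ^ 2
      * ‖sampleGrad f y.1.2.1 y.1.2.2 - sampleGrad f y.1.2.1 y.2‖ ^ 2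
  have hx : Measurable (fun y : (ℝ × EuclideanSpace ℝ (Fin d) × Ξ) × Ξ => y.1.2.1) := by fun_prop
  have hw : Measurable (fun y : (ℝ × EuclideanSpace ℝ (Fin d) × Ξ) × Ξ => y.1.2.2) := by fun_prop
  have hg : Measurable g := Measurable.mul (by fun_prop)
    (((h.measurable_grad.comp (hx.prodMk hw)).sub
      (h.measurable_grad.comp (hx.prodMk measurable_snd))).norm.pow_const 2)
  refine le_integral_fresh (hX.mono (hR.pastSigma_le _) le_rfl) (hR.measurable_sample (k + 1))
    (hR.indepFun_past hX le_rfl) (hR.law_sample (k + 1)) hg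
    ((bddMeas_pathWeight h hR B k).mul ((bddMeas_pathDiff h hR k).norm.pow 2)).integrable
    ((bddMeas_pathWeight h hR B k).mul ((bddMeas_pathNoise h hR le_rfl).norm.pow 2)).integrable
    (Filter.Eventually.of_forall fun ω => ?_)
  simp only [g, X]
  rw [integral_const_mul, pathWeight]
  have hu := one_le_pathU f x₁ (fun i => ξ i ω) k
  gcongr
  exact h.norm_sub_meanGrad_sq_le _ _

/-- The expected logarithm of the sum of the squared gradient differences. -/
lemma integral_log_pathU_cube_le (h : Assumptions 𝒟 f σ β σh) (hR : IsRandomness 𝒟 P T ξ τ)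
    (k : ℕ) : ∫ ω, Real.log (pathU f x₁ (fun i => ξ i ω) k ^ 3) ∂P
      ≤ Real.log (1 + 4 * σ ^ 2 * k) := by
  have hm : (0 : ℝ) < 1 + 4 * σ ^ 2 * k := by positivity
  have hu : ∀ ω, 1 ≤ pathU f x₁ (fun i => ξ i ω) k ^ 3 :=
    fun ω => one_le_pow₀ (one_le_pathU f x₁ _ k)
  have hi := (bddMeas_pathU_cube h hR (x₁ := x₁) k).integrable
  -- The tangent of `log` at the bound for the mean takes the place of Jensen's inequality.
  have h1 : ∫ ω, Real.log (pathU f x₁ (fun i => ξ i ω) k ^ 3) ∂P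
      ≤ ∫ ω, (pathU f x₁ (fun i => ξ i ω) k ^ 3 / (1 + 4 * σ ^ 2 * k)
        + (Real.log (1 + 4 * σ ^ 2 * k) - 1)) ∂P := by
    refine integral_mono ((bddMeas_pathU_cube h hR k).log hu).integrable
      ((hi.div_const _).add (integrable_const _)) fun ω => ?_
    have := log_le_div_add_log (lt_of_lt_of_le one_pos (hu ω)) hm
    simp only
    linarith
  rw [integral_add (hi.div_const _) (integrable_const _), integral_div] at h1
  have h2 := (div_le_one hm).2 (integral_pathU_cube_le (x₁ := x₁) h hR k)
  simp only [integral_const, probReal_univ, smul_eq_mul, one_mul] at h1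
  linarith

lemma bddMeas_log_pathD (h : Assumptions 𝒟 f σ β σh) (hR : IsRandomness 𝒟 P T ξ τ) (k : ℕ) :
    BddMeas P (fun ω => Real.log (pathD f x₁ (fun i => ξ i ω) k)) :=
  (bddMeas_pathD h hR k).log fun _ => one_le_pathD f x₁ _ k

/-- The expected weighted sum of the squared errors. -/
lemma integral_pathW_le (h : Assumptions 𝒟 f σ β σh) (hR : IsRandomness 𝒟 P T ξ τ) {B : ℝ}
    (hB : B = 16 * σh ^ 2) (n : ℕ) :
    3 / 8 * ∫ ω, pathW 𝒟 f x₁ (fun i => ξ i ω) (n + 1) ∂P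
      ≤ (1 + 8 * B) * σ ^ 2
        + 1200 * (1 + B) ^ 2 * β ^ 2 * ∫ ω, Real.log (pathD f x₁ (fun i => ξ i ω) n) ∂P
        + 2 * ((1 + 8 * B) * (1 + B)) * Real.log (1 + 4 * σ ^ 2 * ((n + 2 : ℕ) : ℝ))
        + 129 * (1 + B) ^ 3 := by
  have hB0 : 0 ≤ B := by rw [hB]; positivity
  have i0 := ((bddMeas_pathErr h hR (x₁ := x₁) 0).norm.pow 2).integrable.const_mul (1 + 8 * B)
  have i1 := (BddMeas.sum (Finset.range (n + 1))
    fun k => bddMeas_pathLin h hR (x₁ := x₁) B k).integrable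
  have i2' := fun k => ((bddMeas_pathU h hR (x₁ := x₁) k).mul
    ((bddMeas_pathZ h hR (x₁ := x₁) k).norm.pow 2))
  have i2 := (BddMeas.sum (Finset.range (n + 1)) i2').integrable.const_mul (300 * (1 + B) ^ 2)
  have i3' := fun k => (bddMeas_pathWeight h hR (x₁ := x₁) B (k + 1)).mul
    ((bddMeas_pathNoise h hR (x₁ := x₁) (le_refl (k + 1))).norm.pow 2)
  have i3 := (BddMeas.sum (Finset.range (n + 1)) i3').integrable.const_mul 2
  have hle := integral_mono_ae ((bddMeas_pathW h hR (x₁ := x₁) (n + 1)).integrable.const_mul (3 / 8))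
    ((((i0.add i1).add i2).add i3).add (integrable_const (129 * (1 + B) ^ 3)))
    ((ae_noiseBound h hR).mono fun ω hω => hω.pathW_le hB (n + 1))
  simp only [Pi.add_apply] at hle
  rw [integral_add ?_ (integrable_const _), integral_add ?_ i3, integral_add ?_ i2,
    integral_add i0 i1, integral_const_mul, integral_const_mul, integral_const_mul,
    integral_const_mul, integral_finsetSum _ fun k _ => (bddMeas_pathLin h hR B k).integrable,
    integral_finsetSum _ fun k _ => (i2' k).integrable,
    integral_finsetSum _ fun k _ => (i3' k).integrable] at hle
  rotate_left
  · exact i0.add i1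
  · exact (i0.add i1).add i2
  · exact ((i0.add i1).add i2).add i3
  simp only [integral_pathLin h hR, Finset.sum_const_zero, integral_const, probReal_univ,
    smul_eq_mul, one_mul] at hle
  have e0 : ∫ ω, ‖pathErr 𝒟 f x₁ (fun i => ξ i ω) 0‖ ^ 2 ∂P ≤ σ ^ 2 := by
    simp only [pathErr_zero]
    exact integral_norm_pathNoise_sq_le h hR le_rfl
  have e2 : ∑ k ∈ Finset.range (n + 1),
      ∫ ω, pathU f x₁ (fun i => ξ i ω) k * ‖pathZ 𝒟 f x₁ (fun i => ξ i ω) k‖ ^ 2 ∂P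
      ≤ 4 * β ^ 2 * ∫ ω, Real.log (pathD f x₁ (fun i => ξ i ω) n) ∂P := by
    refine (Finset.sum_le_sum fun k _ => integral_pathU_mul_norm_pathZ_sq_le h hR k).trans ?_
    rw [← Finset.mul_sum, ← integral_finsetSum _ fun k _ =>
      (bddMeas_norm_pathM_sq_div h hR k).integrable]
    gcongr
    · exact (BddMeas.sum _ fun k => bddMeas_norm_pathM_sq_div h hR k).integrable
    · exact (bddMeas_log_pathD h hR n).integrable
    · exact fun ω => sum_norm_pathM_sq_div_le f x₁ (fun i => ξ i ω) n
  have e3 : ∑ k ∈ Finset.range (n + 1), ∫ ω, pathWeight f x₁ B (fun i => ξ i ω) (k + 1)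
        * ‖pathNoise 𝒟 f x₁ (fun i => ξ i ω) (k + 1) (k + 1)‖ ^ 2 ∂P
      ≤ (1 + 8 * B) * (1 + B) * Real.log (1 + 4 * σ ^ 2 * ((n + 2 : ℕ) : ℝ)) := by
    refine (Finset.sum_le_sum fun k _ =>
      integral_pathWeight_mul_norm_pathNoise_sq_le h hR hB0 (k + 1)).trans ?_
    have hwd := fun k => (bddMeas_pathWeight h hR (x₁ := x₁) B k).mul
      ((bddMeas_pathDiff h hR (x₁ := x₁) k).norm.pow 2)
    have hlog := ((bddMeas_pathU_cube h hR (x₁ := x₁) (n + 2)).log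
      fun ω => one_le_pow₀ (one_le_pathU f x₁ _ _)).integrable
    rw [← integral_finsetSum _ fun k _ => (hwd (k + 1)).integrable]
    refine le_trans (integral_mono_ae (BddMeas.sum _ fun k => hwd (k + 1)).integrable
      (hlog.const_mul ((1 + 8 * B) * (1 + B))) ((ae_noiseBound (x₁ := x₁) h hR).mono fun ω hω => ?_)) ?_
    · have h1 := sum_weight_norm_pathDiff_sq_le f x₁ (fun i => ξ i ω) hB0
        (fun k => hB ▸ hω.norm_pathDiff_sq_le k) (n + 2)
      refine le_trans ?_ h1
      -- The noises carry the indices `1, …, n + 1`; the nonnegative summand at `0` is added, which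
      -- is why the logarithm is taken at `n + 2`.
      rw [Finset.sum_range_succ' _ (n + 1)]
      have hu := one_le_pathU f x₁ (fun i => ξ i ω) 0
      exact le_add_of_nonneg_right (by positivity)
    · rw [integral_const_mul]
      gcongr
      exact integral_log_pathU_cube_le h hR (n + 2)
  have e0' := mul_le_mul_of_nonneg_left e0 (by positivity : 0 ≤ 1 + 8 * B)
  have e2' := mul_le_mul_of_nonneg_left e2 (by positivity : 0 ≤ 300 * (1 + B) ^ 2)
  linarith

end Expectation

/-! ### Resolving the coupled inequalities. -/

section Constants

/-- Resolving the coupled bounds on the momentum sum `y`, the error sum `w` and the expected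
logarithm `l` of the momentum sum. -/
lemma coupled_bounds {K k s L Δ b y w l : ℝ} (hK : 3 ≤ K) (hk : 1 ≤ k) (hs : 0 ≤ s)
    (hL : 0 ≤ L) (hΔ : 0 ≤ Δ) (hb : b ≤ k) (hl : 0 ≤ l)
    (hy : y ≤ 1 + Δ + w / (2 * k) + (k / 2 + b) * l)
    (hw : w ≤ K * k * (s + k * l + k * (1 + L)))
    (hlog : ∀ m : ℝ, 0 < m → l ≤ 2 * (y / m + Real.log m) + 1 + L) :
    y ≤ 24 * K ^ 2 * (1 + Δ + s + k * Real.log k + k * L)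
    ∧ w ≤ 30 * K ^ 2 * k * (1 + Δ + s + k * Real.log k + k * L) := by
  have hk0 : 0 < k := by linarith
  have hK0 : 0 ≤ K := by linarith
  have hlk : 0 ≤ Real.log k := Real.log_nonneg hk
  have hkk : k - 1 ≤ k * Real.log k := by
    have := Real.one_sub_inv_le_log_of_pos hk0
    have h2 := mul_le_mul_of_nonneg_left this hk0.le
    rwa [mul_sub, mul_one, mul_inv_cancel₀ hk0.ne'] at h2
  have hkL : 0 ≤ k * L := by positivity
  set κ := 1 + Δ + s + k * Real.log k + k * L with hκ
  have hkκ : k ≤ κ := by linarith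
  have hκ1 : 1 ≤ κ := hk.trans hkκ
  have hw' : w / (2 * k) ≤ K / 2 * (s + k * l + k * (1 + L)) := by
    rw [div_le_iff₀ (by positivity)]
    calc w ≤ _ := hw
      _ = _ := by ring
  have h4K : Real.log (4 * K) ≤ 4 * K := Real.log_le_self (by linarith)
  have hm : k * l ≤ y / (2 * K) + 2 * k * (4 * K + Real.log k) + k * (1 + L) := by
    -- The tangent point is chosen so that `K (k l)` contains `y` with coefficient exactly `1/2`,
    -- which can be absorbed on the left.
    have h1 := hlog (4 * K * k) (by positivity)
    rw [Real.log_mul (by positivity) hk0.ne'] at h1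
    have h2 := mul_le_mul_of_nonneg_left h1 hk0.le
    have h3 : k * (2 * (y / (4 * K * k) + (Real.log (4 * K) + Real.log k)) + 1 + L)
        = y / (2 * K) + 2 * k * (Real.log (4 * K) + Real.log k) + k * (1 + L) := by
      field_simp; ring
    rw [h3] at h2
    have h4 : 2 * k * (Real.log (4 * K) + Real.log k) ≤ 2 * k * (4 * K + Real.log k) := by gcongr
    linarith
  have hkl : 0 ≤ k * l := by positivity
  have hy1 : y ≤ 1 + Δ + K * (s + k * (1 + L)) + K * (k * l) := by
    have h1 := mul_le_mul_of_nonneg_right hb hl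
    have h2 : 0 ≤ K * (s + k * (1 + L)) := by positivity
    have h3 := mul_le_mul_of_nonneg_right hK hkl
    linarith
  have hKm : K * (k * l) ≤ y / 2 + K * (2 * k * (4 * K + Real.log k)) + K * (k * (1 + L)) := by
    have := mul_le_mul_of_nonneg_left hm (by linarith : 0 ≤ K)
    have h3 : K * (y / (2 * K) + 2 * k * (4 * K + Real.log k) + k * (1 + L))
      = y / 2 + K * (2 * k * (4 * K + Real.log k)) + K * (k * (1 + L)) := by field_simp
    rwa [h3] at this
  have hKκ : K * k ≤ K * κ := by gcongr
  have hKKκ : K ^ 2 * k ≤ K ^ 2 * κ := by gcongr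
  have hKK : 3 * (K * κ) ≤ K ^ 2 * κ := by
    have := mul_le_mul_of_nonneg_right hK (by positivity : 0 ≤ K * κ)
    linarith
  have hterms : s + k * L + k * Real.log k + (1 + Δ) = κ := by rw [hκ]; ring
  have hklk : 0 ≤ k * Real.log k := by positivity
  have hyκ : y ≤ 24 * K ^ 2 * κ := by
    have h1 : 1 + Δ + 2 * K * (s + k * L + k * Real.log k) ≤ 2 * (K * κ) := by
      rw [← hterms]
      have := mul_le_mul_of_nonneg_right hK (by linarith : 0 ≤ 1 + Δ)
      linarith
    have hKs : 0 ≤ K * s := by positivity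
    have hK2 : 0 ≤ K ^ 2 * κ := by positivity
    linarith
  refine ⟨hyκ, hw.trans ?_⟩
  have hyK : y / (2 * K) ≤ 12 * (K * κ) := by
    rw [div_le_iff₀ (by linarith)]
    calc y ≤ _ := hyκ
      _ = _ := by ring
  have hκκ : 3 * κ ≤ K * κ := by gcongr
  have h5 : s + k * l + k * (1 + L) ≤ 30 * (K * κ) := by linarith
  calc K * k * (s + k * l + k * (1 + L)) ≤ K * k * (30 * (K * κ)) := by gcongr
    _ = _ := by ring

/-- The polynomial factors in `σ̂` are bounded by powers of `1 + σ̂³`. -/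
lemma variance_factor_bounds {s B : ℝ} (hs : 0 ≤ s) (hB : B = 16 * s ^ 2) :
    1 + 8 * B ≤ 129 * (1 + s ^ 3) ∧ 1 + B ≤ 17 * (1 + s ^ 3)
    ∧ (1 + B) ^ 3 ≤ 16384 * (1 + s ^ 3) ^ 2 := by
  have h1 : s ^ 2 ≤ 1 + s ^ 3 := by
    rcases le_total s 1 with h | h
    · nlinarith [pow_nonneg hs 3]
    · nlinarith [sq_nonneg s]
  have hs3 : 0 ≤ s ^ 3 := by positivity
  refine ⟨by rw [hB]; linarith, by rw [hB]; linarith, ?_⟩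
  -- Cubing the bound for `1 + B` would give degree nine in `s`; treating `1 + s²` directly keeps
  -- degree six, hence the square of `1 + s³`.
  have h2 : (1 + B) ^ 3 ≤ (16 * (1 + s ^ 2)) ^ 3 := by
    have : 0 ≤ B := by rw [hB]; positivity
    gcongr
    rw [hB]; linarith
  have h3 : (1 + s ^ 2) ^ 3 ≤ 4 * (1 + s ^ 6) := by
    nlinarith [mul_nonneg (by positivity : 0 ≤ 1 + s ^ 2) (sq_nonneg (1 - s ^ 2))]
  nlinarith

end Constants

/-! ### The expected size of the momentum and error sums. -/

section Rate

variable {d : ℕ} {Ξ Ω : Type*} [MeasurableSpace Ξ] [MeasurableSpace Ω] {𝒟 : Measure Ξ}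
  {P : Measure Ω} {f : EuclideanSpace ℝ (Fin d) → Ξ → ℝ} {σ β σh : ℝ}
  {x₁ : EuclideanSpace ℝ (Fin d)} {T : ℕ} {ξ : ℕ → Ω → Ξ} {τ : Ω → ℕ}
  [IsProbabilityMeasure 𝒟] [IsProbabilityMeasure P]

lemma bddMeas_sqrt_pathD_div (h : Assumptions 𝒟 f σ β σh) (hR : IsRandomness 𝒟 P T ξ τ) (n : ℕ) :
    BddMeas P (fun ω => √(pathD f x₁ (fun i => ξ i ω) n / pathU f x₁ (fun i => ξ i ω) n)) :=
  ((bddMeas_pathD h hR n).mul (bddMeas_inv_pathU h hR n)).sqrt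

lemma log_one_add_four_mul_le {σ : ℝ} {k n : ℕ} (hk : k ≤ 2 * (n + 1)) :
    Real.log (1 + 4 * σ ^ 2 * (k : ℝ)) ≤ 3 + Real.log (1 + σ ^ 2 * ((n + 1 : ℕ) : ℝ)) := by
  have hk' : (k : ℝ) ≤ 2 * ((n + 1 : ℕ) : ℝ) := by exact_mod_cast hk
  have h8 : Real.log 8 ≤ 3 := by
    rw [show (8 : ℝ) = 2 ^ 3 by norm_num, Real.log_pow]
    have := Real.log_two_lt_d9
    push_cast; linarith
  have hpos : (0 : ℝ) < 1 + σ ^ 2 * ((n + 1 : ℕ) : ℝ) := by positivity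
  calc Real.log (1 + 4 * σ ^ 2 * (k : ℝ)) ≤ Real.log (8 * (1 + σ ^ 2 * ((n + 1 : ℕ) : ℝ))) := by
        refine Real.log_le_log (by positivity) ?_
        nlinarith [mul_le_mul_of_nonneg_left hk' (sq_nonneg σ)]
    _ = Real.log 8 + Real.log (1 + σ ^ 2 * ((n + 1 : ℕ) : ℝ)) :=
        Real.log_mul (by norm_num) hpos.ne'
    _ ≤ _ := by linarith

/-- The expected logarithm of the momentum sum in terms of the expected momentum sum. -/
lemma integral_log_pathD_le (h : Assumptions 𝒟 f σ β σh) (hR : IsRandomness 𝒟 P T ξ τ) (n : ℕ)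
    {m : ℝ} (hm : 0 < m) : ∫ ω, Real.log (pathD f x₁ (fun i => ξ i ω) n) ∂P
      ≤ 2 * ((∫ ω, √(pathD f x₁ (fun i => ξ i ω) n / pathU f x₁ (fun i => ξ i ω) n) ∂P) / m
        + Real.log m) + 1 + Real.log (1 + σ ^ 2 * ((n + 1 : ℕ) : ℝ)) := by
  have hY := (bddMeas_sqrt_pathD_div h hR (x₁ := x₁) n).integrable
  have hU := ((bddMeas_pathU_cube h hR (x₁ := x₁) n).log
    fun ω => one_le_pow₀ (one_le_pathU f x₁ _ n)).integrable
  have hle : ∫ ω, Real.log (pathD f x₁ (fun i => ξ i ω) n) ∂P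
      ≤ ∫ ω, (2 / m * √(pathD f x₁ (fun i => ξ i ω) n / pathU f x₁ (fun i => ξ i ω) n)
        + (2 * Real.log m - 2) + 3⁻¹ * Real.log (pathU f x₁ (fun i => ξ i ω) n ^ 3)) ∂P := by
    refine integral_mono (bddMeas_log_pathD h hR n).integrable
      (((hY.const_mul _).add (integrable_const _)).add (hU.const_mul _)) fun ω => ?_
    have hD1 := one_le_pathD f x₁ (fun i => ξ i ω) n
    have hU1 := one_le_pathU f x₁ (fun i => ξ i ω) n
    have hq : 0 < pathD f x₁ (fun i => ξ i ω) n / pathU f x₁ (fun i => ξ i ω) n := by positivity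
    -- This rests on `log D = 2 log √(D / u) + (1/3) log u³`, with the tangent of `log` at `m`
    -- applied to the first part.
    have h1 := log_le_div_add_log (Real.sqrt_pos.2 hq) hm
    rw [Real.log_sqrt hq.le, Real.log_div (by positivity) (by positivity)] at h1
    simp only [Real.log_pow]
    push_cast
    have h2 : 2 / m * √(pathD f x₁ (fun i => ξ i ω) n / pathU f x₁ (fun i => ξ i ω) n)
      = 2 * (√(pathD f x₁ (fun i => ξ i ω) n / pathU f x₁ (fun i => ξ i ω) n) / m) := by ring
    rw [h2]
    linarith
  have i1 : Integrable (fun ω =>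
      2 / m * √(pathD f x₁ (fun i => ξ i ω) n / pathU f x₁ (fun i => ξ i ω) n)
        + (2 * Real.log m - 2)) P := (hY.const_mul _).add (integrable_const _)
  rw [integral_add i1 (hU.const_mul _), integral_add (hY.const_mul _) (integrable_const _),
    integral_const_mul, integral_const_mul] at hle
  simp only [integral_const, probReal_univ, smul_eq_mul, one_mul] at hle
  have h3 := (integral_log_pathU_cube_le (x₁ := x₁) h hR n).trans
    (log_one_add_four_mul_le (σ := σ) (by omega : n ≤ 2 * (n + 1)))
  have hL : 0 ≤ Real.log (1 + σ ^ 2 * ((n + 1 : ℕ) : ℝ)) :=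
    Real.log_nonneg (le_add_of_nonneg_right (by positivity))
  refine hle.trans ?_
  rw [div_mul_eq_mul_div, mul_div_assoc]
  linarith

lemma one_le_kappa₂ (h : 0 ≤ σh) : 1 ≤ kappa₂ β σh := by
  rw [kappa₂]
  exact one_le_mul_of_one_le_of_one_le (le_add_of_nonneg_right (by positivity)) (le_max_right _ _)

lemma le_kappa₂ (h : 0 ≤ σh) : β ≤ kappa₂ β σh :=
  (le_max_left _ _).trans (le_mul_of_one_le_left (zero_le_one.trans (le_max_right _ _))
    (le_add_of_nonneg_right (by positivity)))

/-- The expected momentum and error sums are of the order of `κ₁ + κ₂ log(1 + σ² T)`. -/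
lemma integral_sqrt_add_sqrt_le (h : Assumptions 𝒟 f σ β σh) (hR : IsRandomness 𝒟 P T ξ τ)
    (n : ℕ) :
    ∫ ω, (√(pathD f x₁ (fun i => ξ i ω) n / pathU f x₁ (fun i => ξ i ω) n)
        + √(pathW 𝒟 f x₁ (fun i => ξ i ω) (n + 1))) ∂P
      ≤ 40 * (10 ^ 7) ^ 2 * (kappa₁ (objective 𝒟 f x₁ - ⨅ x, objective 𝒟 f x) σ β σh
        + kappa₂ β σh * Real.log (1 + σ ^ 2 * ((n + 1 : ℕ) : ℝ))) := by
  obtain ⟨hB1, hB2, hB3⟩ := variance_factor_bounds h.sigmaHat_nonneg rfl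
  have hWle := integral_pathW_le (x₁ := x₁) h hR rfl n
  have hk := one_le_kappa₂ (β := β) h.sigmaHat_nonneg
  have hbk := le_kappa₂ (β := β) h.sigmaHat_nonneg
  have hY := (bddMeas_sqrt_pathD_div h hR (x₁ := x₁) n).integrable
  have hW := (bddMeas_pathW h hR (x₁ := x₁) (n + 1))
  have hD := (bddMeas_log_pathD h hR (x₁ := x₁) n).integrable
  have hlogm := log_one_add_four_mul_le (σ := σ) (by omega : n + 2 ≤ 2 * (n + 1))
  have hL : 0 ≤ Real.log (1 + σ ^ 2 * ((n + 1 : ℕ) : ℝ)) :=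
    Real.log_nonneg (le_add_of_nonneg_right (by positivity))
  have hΔ : 0 ≤ objective 𝒟 f x₁ - ⨅ x, objective 𝒟 f x :=
    sub_nonneg.2 (ciInf_le h.lower_bounded _)
  have hl : 0 ≤ ∫ ω, Real.log (pathD f x₁ (fun i => ξ i ω) n) ∂P :=
    integral_nonneg fun ω => Real.log_nonneg (one_le_pathD f x₁ _ n)
  have hs3 : 0 ≤ σh ^ 3 := pow_nonneg h.sigmaHat_nonneg 3
  have hlogD := fun m hm => integral_log_pathD_le (x₁ := x₁) h hR n (m := m) hm
  -- The free parameter is `κ₂`: as `W` is of order `κ₂² log D`, both `W / κ₂` and `κ₂ log D` then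
  -- have the same order.
  have hYle : ∫ ω, √(pathD f x₁ (fun i => ξ i ω) n / pathU f x₁ (fun i => ξ i ω) n) ∂P
      ≤ 1 + (objective 𝒟 f x₁ - ⨅ x, objective 𝒟 f x)
        + (∫ ω, pathW 𝒟 f x₁ (fun i => ξ i ω) (n + 1) ∂P) / (2 * kappa₂ β σh)
        + (kappa₂ β σh / 2 + β) * ∫ ω, Real.log (pathD f x₁ (fun i => ξ i ω) n) ∂P := by
    have i1 : Integrable (fun ω => 1 + (objective 𝒟 f x₁ - ⨅ x, objective 𝒟 f x)
        + pathW 𝒟 f x₁ (fun i => ξ i ω) (n + 1) / (2 * kappa₂ β σh)) P :=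
      (integrable_const _).add (hW.integrable.div_const _)
    have := integral_mono hY (i1.add (hD.const_mul (kappa₂ β σh / 2 + β)))
      fun ω => h.sqrt_pathD_div_le (by linarith) n
    simp only [Pi.add_apply] at this
    rw [integral_add i1 (hD.const_mul _), integral_add (integrable_const _)
      (hW.integrable.div_const _), integral_div, integral_const_mul] at this
    simpa using this
  have hsq : ∫ ω, √(pathW 𝒟 f x₁ (fun i => ξ i ω) (n + 1)) ∂P
      ≤ (∫ ω, pathW 𝒟 f x₁ (fun i => ξ i ω) (n + 1) ∂P) / (2 * kappa₂ β σh)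
        + kappa₂ β σh / 2 := by
    have := integral_mono hW.sqrt.integrable
      ((hW.integrable.div_const (2 * kappa₂ β σh)).add (integrable_const (kappa₂ β σh / 2)))
      fun ω => (by
        have hw : 0 ≤ pathW 𝒟 f x₁ (fun i => ξ i ω) (n + 1) := pathW_nonneg _
        have h1 := Real.sq_sqrt hw
        have h2 := sq_nonneg (√(pathW 𝒟 f x₁ (fun i => ξ i ω) (n + 1)) - kappa₂ β σh)
        simp only [Pi.add_apply]
        rw [div_add' _ _ _ (by positivity), le_div_iff₀ (by positivity)]
        nlinarith : √(pathW 𝒟 f x₁ (fun i => ξ i ω) (n + 1)) ≤ _)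
    simp only [Pi.add_apply] at this
    rw [integral_add (hW.integrable.div_const _) (integrable_const _), integral_div] at this
    simpa using this
  rw [integral_add hY hW.sqrt.integrable]
  have hHk : 1 + σh ^ 3 ≤ kappa₂ β σh := by
    rw [kappa₂]; exact le_mul_of_one_le_right (by linarith) (le_max_right _ _)
  have hHb : (1 + σh ^ 3) * β ≤ kappa₂ β σh := by
    rw [kappa₂]; exact mul_le_mul_of_nonneg_left (le_max_left _ _) (by linarith)
  have hκ : 1 + (objective 𝒟 f x₁ - ⨅ x, objective 𝒟 f x) + σ ^ 2
        + kappa₂ β σh * Real.log (kappa₂ β σh)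
        + kappa₂ β σh * Real.log (1 + σ ^ 2 * ((n + 1 : ℕ) : ℝ))
      ≤ kappa₁ (objective 𝒟 f x₁ - ⨅ x, objective 𝒟 f x) σ β σh
        + kappa₂ β σh * Real.log (1 + σ ^ 2 * ((n + 1 : ℕ) : ℝ)) := by
    have := mul_nonneg h.sigmaHat_nonneg h.sigma_nonneg
    rw [kappa₁]; linarith
  generalize ∫ ω, √(pathD f x₁ (fun i => ξ i ω) n / pathU f x₁ (fun i => ξ i ω) n) ∂P = y at *
  generalize ∫ ω, pathW 𝒟 f x₁ (fun i => ξ i ω) (n + 1) ∂P = w at *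
  generalize ∫ ω, Real.log (pathD f x₁ (fun i => ξ i ω) n) ∂P = l at *
  generalize ∫ ω, √(pathW 𝒟 f x₁ (fun i => ξ i ω) (n + 1)) ∂P = v at *
  have hβ := h.beta_nonneg
  -- The constant comes from the terms without a logarithm: `(3 · 4386 + 2113536) · 8/3 < 10 ^ 7`.
  have hw : w ≤ 10 ^ 7 * kappa₂ β σh * (σ ^ 2 + kappa₂ β σh * l
      + kappa₂ β σh * (1 + Real.log (1 + σ ^ 2 * ((n + 1 : ℕ) : ℝ)))) := by
    have t1 : (1 + 8 * (16 * σh ^ 2)) * σ ^ 2 ≤ 129 * (kappa₂ β σh * σ ^ 2) := by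
      calc _ ≤ 129 * (1 + σh ^ 3) * σ ^ 2 := by gcongr
        _ ≤ 129 * kappa₂ β σh * σ ^ 2 := by gcongr
        _ = _ := by ring
    have t2 : 1200 * (1 + 16 * σh ^ 2) ^ 2 * β ^ 2 * l ≤ 346800 * (kappa₂ β σh ^ 2 * l) := by
      calc _ ≤ 1200 * (17 * (1 + σh ^ 3)) ^ 2 * β ^ 2 * l := by gcongr
        _ = 346800 * (((1 + σh ^ 3) * β) ^ 2 * l) := by ring
        _ ≤ _ := by gcongr
    have hlm : 0 ≤ Real.log (1 + 4 * σ ^ 2 * ((n + 2 : ℕ) : ℝ)) :=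
      Real.log_nonneg (le_add_of_nonneg_right (by positivity))
    have t3 : 2 * ((1 + 8 * (16 * σh ^ 2)) * (1 + 16 * σh ^ 2))
          * Real.log (1 + 4 * σ ^ 2 * ((n + 2 : ℕ) : ℝ))
        ≤ 4386 * (kappa₂ β σh ^ 2 * (3 + Real.log (1 + σ ^ 2 * ((n + 1 : ℕ) : ℝ)))) := by
      calc _ ≤ 2 * ((129 * (1 + σh ^ 3)) * (17 * (1 + σh ^ 3)))
            * (3 + Real.log (1 + σ ^ 2 * ((n + 1 : ℕ) : ℝ))) := by gcongr
        _ = 4386 * ((1 + σh ^ 3) ^ 2 * (3 + Real.log (1 + σ ^ 2 * ((n + 1 : ℕ) : ℝ)))) := by ring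
        _ ≤ _ := by gcongr
    have t4 : 129 * (1 + 16 * σh ^ 2) ^ 3 ≤ 2113536 * kappa₂ β σh ^ 2 := by
      calc _ ≤ 129 * (16384 * (1 + σh ^ 3) ^ 2) := by gcongr
        _ = 2113536 * (1 + σh ^ 3) ^ 2 := by ring
        _ ≤ _ := by gcongr
    have p1 : 0 ≤ kappa₂ β σh * σ ^ 2 := by positivity
    have p2 : 0 ≤ kappa₂ β σh ^ 2 * l := by positivity
    have p3 : 0 ≤ kappa₂ β σh ^ 2 * Real.log (1 + σ ^ 2 * ((n + 1 : ℕ) : ℝ)) := by positivity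
    have p4 : 0 ≤ kappa₂ β σh ^ 2 := by positivity
    linarith
  obtain ⟨hy', hw'⟩ := coupled_bounds (by norm_num) hk (sq_nonneg σ) hL hΔ hbk hl hYle hw hlogD
  refine le_trans ?_ (mul_le_mul_of_nonneg_left hκ (by norm_num))
  have hkk : kappa₂ β σh - 1 ≤ kappa₂ β σh * Real.log (kappa₂ β σh) := by
    have h2 := mul_le_mul_of_nonneg_left (Real.one_sub_inv_le_log_of_pos (by linarith :
      0 < kappa₂ β σh)) (by linarith : 0 ≤ kappa₂ β σh)
    rwa [mul_sub, mul_one, mul_inv_cancel₀ (by linarith)] at h2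
  have hkL : 0 ≤ kappa₂ β σh * Real.log (1 + σ ^ 2 * ((n + 1 : ℕ) : ℝ)) := by positivity
  set κ := 1 + (objective 𝒟 f x₁ - ⨅ x, objective 𝒟 f x) + σ ^ 2
    + kappa₂ β σh * Real.log (kappa₂ β σh)
    + kappa₂ β σh * Real.log (1 + σ ^ 2 * ((n + 1 : ℕ) : ℝ)) with hκdef
  have hkκ : kappa₂ β σh ≤ κ := by linarith [sq_nonneg σ]
  -- The final `40` covers `24` for the momentum part, `15` from here and the remaining `κ₂ / 2`.
  have hwk : w / (2 * kappa₂ β σh) ≤ 15 * (10 ^ 7) ^ 2 * κ := by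
    rw [div_le_iff₀ (by positivity)]
    calc w ≤ _ := hw'
      _ = _ := by ring
  linarith

end Rate

/-! ### The tail of the gradient norm at a random index. -/

/-- A proportion that is bounded by `s^{1/3} v² δ^{7/3}` is bounded by `δ` times a mean of `s` and
`v`. -/
lemma le_mul_mean_of_le {c s v δ : ℝ} (hc0 : 0 ≤ c) (hc1 : c ≤ 1) (hs : 0 ≤ s) (hv : 0 ≤ v)
    (hδ : 0 ≤ δ) (h : c ≤ s ^ (1 / 3 : ℝ) * v ^ 2 * δ ^ (7 / 3 : ℝ)) :
    c ≤ δ * (1 / 7 * s + 6 / 7 * v) := by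
  -- The exponent `3/7` is forced: it sends the exponents `1/3` and `2` to `1/7` and `6/7`, which
  -- sum to one, and `δ^{7/3}` to `δ`.
  have h1 : c ≤ c ^ (3 / 7 : ℝ) := by
    rcases hc0.eq_or_lt with h0 | h0
    · rw [← h0]; positivity
    · calc c = c ^ (1 : ℝ) := (Real.rpow_one c).symm
        _ ≤ _ := Real.rpow_le_rpow_of_exponent_ge h0 hc1 (by norm_num)
  have h2 : (s ^ (1 / 3 : ℝ) * v ^ 2 * δ ^ (7 / 3 : ℝ)) ^ (3 / 7 : ℝ)
      = s ^ (1 / 7 : ℝ) * v ^ (6 / 7 : ℝ) * δ := by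
    rw [Real.mul_rpow (by positivity) (by positivity), Real.mul_rpow (by positivity)
      (by positivity), ← Real.rpow_mul hs, ← Real.rpow_mul hδ, ← Real.rpow_natCast,
      ← Real.rpow_mul hv]
    norm_num
  calc c ≤ _ := h1
    _ ≤ (s ^ (1 / 3 : ℝ) * v ^ 2 * δ ^ (7 / 3 : ℝ)) ^ (3 / 7 : ℝ) :=
        Real.rpow_le_rpow hc0 h (by norm_num)
    _ = δ * (s ^ (1 / 7 : ℝ) * v ^ (6 / 7 : ℝ)) := by rw [h2]; ring
    _ ≤ _ := by
        gcongr
        exact Real.geom_mean_le_arith_mean2_weighted (by norm_num) (by norm_num) hs hv (by norm_num)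

section Tail

variable {d : ℕ} {Ξ Ω : Type*} [MeasurableSpace Ξ] [MeasurableSpace Ω] {𝒟 : Measure Ξ}
  {P : Measure Ω} {f : EuclideanSpace ℝ (Fin d) → Ξ → ℝ} {σ β σh : ℝ}
  {x₁ : EuclideanSpace ℝ (Fin d)} {T : ℕ} {ξ : ℕ → Ω → Ξ} {τ : Ω → ℕ}

lemma IsRandomness.measure_index_eq (hR : IsRandomness 𝒟 P T ξ τ) {k : ℕ} (hk : k < T) :
    P (τ ⁻¹' {k}) = (T : ENNReal)⁻¹ := by
  rw [← Measure.map_apply hR.measurable_index (measurableSet_singleton k), hR.law_index,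
    ← Finset.coe_range, ← Finset.coe_singleton, uniformOn_apply_finset,
    Finset.inter_singleton_of_mem (Finset.mem_range.2 hk)]
  simp

lemma IsRandomness.measure_index_ge (hR : IsRandomness 𝒟 P T ξ τ) :
    P (τ ⁻¹' (Set.Iio T)ᶜ) = 0 := by
  rw [← Measure.map_apply hR.measurable_index (by measurability), hR.law_index,
    uniformOn_eq_zero_iff (Set.finite_Iio T)]
  exact Set.inter_compl_self _

variable [IsProbabilityMeasure 𝒟]

/-- The law of the output is the average of the laws of the iterates. -/
lemma measure_output_gt_le (h : Assumptions 𝒟 f σ β σh) (hR : IsRandomness 𝒟 P T ξ τ) (R : ℝ) :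
    P {ω | R < ‖meanGrad 𝒟 f (output f stdParams x₁ ξ τ ω)‖}
      ≤ ∑ k ∈ Finset.range T,
        (T : ENNReal)⁻¹ * P {ω | R < ‖meanGrad 𝒟 f (pathX f x₁ (fun i => ξ i ω) k)‖} := by
  have hsub : {ω | R < ‖meanGrad 𝒟 f (output f stdParams x₁ ξ τ ω)‖}
      ⊆ τ ⁻¹' (Set.Iio T)ᶜ ∪ ⋃ k ∈ Finset.range T, (τ ⁻¹' {k}
        ∩ {ω | R < ‖meanGrad 𝒟 f (pathX f x₁ (fun i => ξ i ω) k)‖}) := fun ω hω => by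
    by_cases hτ : τ ω < T
    · refine Or.inr (Set.mem_iUnion₂.2 ⟨τ ω, Finset.mem_range.2 hτ, rfl, hω⟩)
    · exact Or.inl hτ
  refine (measure_mono hsub).trans ((measure_union_le _ _).trans ?_)
  rw [hR.measure_index_ge, zero_add]
  refine (measure_biUnion_finset_le _ _).trans (Finset.sum_le_sum fun k hk => le_of_eq ?_)
  have hA : MeasurableSet {z : ℕ → Ξ | R < ‖meanGrad 𝒟 f (pathX f x₁ z k)‖} :=
    measurableSet_lt measurable_const (h.measurable_meanGrad.comp
      (measurable_pathX x₁ h.measurable_grad (fun i (z : ℕ → Ξ) => z i) k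
        fun i _ => measurable_pi_apply i)).norm
  have := hR.indep_index.measure_inter_preimage_eq_mul {k} _ (measurableSet_singleton k) hA
  rw [hR.measure_index_eq (Finset.mem_range.1 hk)] at this
  exact this

variable [IsProbabilityMeasure P]

/-- The tail of the gradient norm at the output, for a threshold `R` with
`T R² ≥ 2 U V² δ^{-7/3}`, where `U³` and `V` bound the expected gradient differences and the
expected momentum and error sums. -/
lemma measure_output_gt_le_of_le (h : Assumptions 𝒟 f σ β σh) {n : ℕ}
    (hR : IsRandomness 𝒟 P (n + 1) ξ τ) {R U V δ : ℝ} (hδ : 0 < δ) (hR0 : 0 ≤ R) (hU : 0 < U)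
    (hV : 0 < V)
    (hUE : ∫ ω, pathU f x₁ (fun i => ξ i ω) n ^ 3 ∂P ≤ U ^ 3)
    (hVE : ∫ ω, (√(pathD f x₁ (fun i => ξ i ω) n / pathU f x₁ (fun i => ξ i ω) n)
        + √(pathW 𝒟 f x₁ (fun i => ξ i ω) (n + 1))) ∂P ≤ V)
    (hTR : 2 * U * V ^ 2 ≤ ((n + 1 : ℕ) : ℝ) * R ^ 2 * δ ^ (7 / 3 : ℝ)) :
    P {ω | R < ‖meanGrad 𝒟 f (output f stdParams x₁ ξ τ ω)‖} ≤ ENNReal.ofReal δ := by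
  have hT : (0 : ℝ) < ((n + 1 : ℕ) : ℝ) := by positivity
  have hA : ∀ k, MeasurableSet {ω | R < ‖meanGrad 𝒟 f (pathX f x₁ (fun i => ξ i ω) k)‖} :=
    fun k => measurableSet_lt measurable_const
      (h.measurable_meanGrad.comp (measurable_pathX' h hR k)).norm
  -- The averaged probability is the expected proportion of iterates whose gradient exceeds `R`,
  -- which can be estimated path by path.
  have hsum : ∑ k ∈ Finset.range (n + 1), (((n + 1 : ℕ) : ENNReal))⁻¹
        * P {ω | R < ‖meanGrad 𝒟 f (pathX f x₁ (fun i => ξ i ω) k)‖}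
      = ENNReal.ofReal (∫ ω, (((n + 1 : ℕ) : ℝ))⁻¹ * ∑ k ∈ Finset.range (n + 1),
        Set.indicator {ω | R < ‖meanGrad 𝒟 f (pathX f x₁ (fun i => ξ i ω) k)‖}
          (fun _ => (1 : ℝ)) ω ∂P) := by
    rw [integral_const_mul, integral_finsetSum _ fun k _ => (integrable_const _).indicator (hA k),
      ← Finset.mul_sum, ENNReal.ofReal_mul (by positivity), ENNReal.ofReal_inv_of_pos hT,
      ENNReal.ofReal_natCast, ENNReal.ofReal_sum_of_nonneg
        fun k _ => integral_nonneg fun ω => Set.indicator_nonneg (fun _ _ => zero_le_one) ω]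
    congr 1
    refine Finset.sum_congr rfl fun k _ => ?_
    rw [integral_indicator (hA k), setIntegral_const, smul_eq_mul, mul_one, measureReal_def,
      ENNReal.ofReal_toReal (measure_ne_top _ _)]
  refine (measure_output_gt_le h hR R).trans (hsum.le.trans (ENNReal.ofReal_le_ofReal ?_))
  have iU := (bddMeas_pathU_cube h hR (x₁ := x₁) n).integrable
  have iV := ((bddMeas_sqrt_pathD_div h hR (x₁ := x₁) n).add
    (bddMeas_pathW h hR (x₁ := x₁) (n + 1)).sqrt).integrable
  have iS := ((integrable_finsetSum (Finset.range (n + 1)) fun k _ =>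
    (integrable_const (μ := P) (1 : ℝ)).indicator (hA k)).const_mul (((n + 1 : ℕ) : ℝ))⁻¹)
  have hle := integral_mono iS
    ((((iU.div_const (U ^ 3)).const_mul (1 / 7)).add
      ((iV.div_const V).const_mul (6 / 7))).const_mul δ) fun ω => (by
      have hUn := one_le_pathU f x₁ (fun i => ξ i ω) n
      have hG := sum_norm_meanGrad_sq_le (𝒟 := 𝒟) (f := f) (x₁ := x₁) (z := fun i => ξ i ω) n
      refine le_mul_mean_of_le ?_ ?_ (by positivity) (by positivity) hδ.le ?_
      · exact mul_nonneg (by positivity)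
          (Finset.sum_nonneg fun k _ => Set.indicator_nonneg (fun _ _ => zero_le_one) ω)
      · rw [inv_mul_le_iff₀ hT, mul_one]
        refine (Finset.sum_le_card_nsmul _ _ 1 fun k _ =>
          Set.indicator_le_self' (fun _ _ => zero_le_one) ω).trans ?_
        simp
      · have hroot : (pathU f x₁ (fun i => ξ i ω) n ^ 3 / U ^ 3) ^ (1 / 3 : ℝ)
            = pathU f x₁ (fun i => ξ i ω) n / U := by
          rw [← div_pow, ← Real.rpow_natCast, ← Real.rpow_mul (by positivity)]
          norm_num
        rw [hroot, inv_mul_le_iff₀ hT]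
        set S := ∑ k ∈ Finset.range (n + 1),
          Set.indicator {ω | R < ‖meanGrad 𝒟 f (pathX f x₁ (fun i => ξ i ω) k)‖}
            (fun _ => (1 : ℝ)) ω
        set G := √(pathD f x₁ (fun i => ξ i ω) n / pathU f x₁ (fun i => ξ i ω) n)
          + √(pathW 𝒟 f x₁ (fun i => ξ i ω) (n + 1))
        -- Markov's inequality for the counting measure on the indices.
        have hS : S * R ^ 2 ≤ 2 * pathU f x₁ (fun i => ξ i ω) n * G ^ 2 := by
          refine le_trans ?_ hG
          rw [Finset.sum_mul]
          refine Finset.sum_le_sum fun k _ => ?_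
          by_cases hk : R < ‖meanGrad 𝒟 f (pathX f x₁ (fun i => ξ i ω) k)‖
          · rw [Set.indicator_of_mem (by exact hk), one_mul]
            exact pow_le_pow_left₀ hR0 hk.le 2
          · rw [Set.indicator_of_notMem (by exact hk), zero_mul]
            positivity
        have hS0 : 0 ≤ S :=
          Finset.sum_nonneg fun k _ => Set.indicator_nonneg (fun _ _ => zero_le_one) ω
        have hδ7 : 0 < δ ^ (7 / 3 : ℝ) := by positivity
        have h1 : S * (2 * U * V ^ 2) ≤ ((n + 1 : ℕ) : ℝ) * δ ^ (7 / 3 : ℝ)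
            * (2 * pathU f x₁ (fun i => ξ i ω) n * G ^ 2) := by
          calc S * (2 * U * V ^ 2) ≤ S * (((n + 1 : ℕ) : ℝ) * R ^ 2 * δ ^ (7 / 3 : ℝ)) := by gcongr
            _ = ((n + 1 : ℕ) : ℝ) * δ ^ (7 / 3 : ℝ) * (S * R ^ 2) := by ring
            _ ≤ _ := by gcongr
        rw [← le_div_iff₀ (by positivity)] at h1
        refine h1.trans (le_of_eq ?_)
        field_simp : _ ≤ δ * (1 / 7 * (pathU f x₁ (fun i => ξ i ω) n ^ 3 / U ^ 3)
          + 6 / 7 * ((√(pathD f x₁ (fun i => ξ i ω) n / pathU f x₁ (fun i => ξ i ω) n)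
          + √(pathW 𝒟 f x₁ (fun i => ξ i ω) (n + 1))) / V)))
  refine hle.trans ?_
  rw [integral_const_mul]
  simp only [Pi.add_apply]
  rw [integral_add ((iU.div_const _).const_mul _) ((iV.div_const _).const_mul _),
    integral_const_mul, integral_const_mul, integral_div, integral_div]
  have h1 := (div_le_one (by positivity : 0 < U ^ 3)).2 hUE
  have h2 := (div_le_one hV).2 hVE
  exact mul_le_of_le_one_right hδ.le (by linarith)

end Tail

end MetaStorm

/-! ### Choice of the threshold and conclusion. -/

theorem corollary4 :
    ∃ C : ℝ, 0 < C ∧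
      ∀ (d : ℕ) (Ξ : Type*) [MeasurableSpace Ξ] (𝒟 : Measure Ξ) [IsProbabilityMeasure 𝒟]
        (f : EuclideanSpace ℝ (Fin d) → Ξ → ℝ) (σ β σh : ℝ),
        MetaStorm.Assumptions 𝒟 f σ β σh →
      ∀ (x₁ : EuclideanSpace ℝ (Fin d)) (T : ℕ), 1 ≤ T →
      ∀ (Ω : Type*) [MeasurableSpace Ω] (P : Measure Ω) [IsProbabilityMeasure P]
        (ξ : ℕ → Ω → Ξ) (τ : Ω → ℕ),
        MetaStorm.IsRandomness 𝒟 P T ξ τ →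
      ∀ δ : ℝ, 0 < δ → δ < 1 →
        ENNReal.ofReal (1 - δ) ≤
          P {ω | ‖gradient (MetaStorm.objective 𝒟 f)
                    (MetaStorm.output f MetaStorm.stdParams x₁ ξ τ ω)‖ ≤
              C * ((MetaStorm.kappa₁
                      (MetaStorm.objective 𝒟 f x₁ - ⨅ x, MetaStorm.objective 𝒟 f x) σ β σh
                    + MetaStorm.kappa₂ β σh * Real.log (1 + σ ^ 2 * T)) / δ ^ (7 / 6 : ℝ))
                * (1 / (T : ℝ) ^ (1 / 2 : ℝ) + σ ^ (1 / 3 : ℝ) / (T : ℝ) ^ (1 / 3 : ℝ))} := by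
  refine ⟨2 * (40 * (10 ^ 7) ^ 2), by norm_num, ?_⟩
  intro d Ξ _ 𝒟 _ f σ β σh h x₁ T hT Ω _ P _ ξ τ hR δ hδ hδ1
  obtain ⟨n, rfl⟩ : ∃ n, T = n + 1 := ⟨T - 1, by omega⟩
  have hσ := h.sigma_nonneg
  have hσh := h.sigmaHat_nonneg
  have hk := MetaStorm.one_le_kappa₂ (β := β) hσh
  have hΔ : 0 ≤ MetaStorm.objective 𝒟 f x₁ - ⨅ x, MetaStorm.objective 𝒟 f x :=
    sub_nonneg.2 (ciInf_le h.lower_bounded _)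
  have hV := MetaStorm.integral_sqrt_add_sqrt_le (x₁ := x₁) h hR n
  have hL : 0 ≤ Real.log (1 + σ ^ 2 * ((n + 1 : ℕ) : ℝ)) :=
    Real.log_nonneg (le_add_of_nonneg_right (by positivity))
  have hκ : 0 < MetaStorm.kappa₁
      (MetaStorm.objective 𝒟 f x₁ - ⨅ x, MetaStorm.objective 𝒟 f x) σ β σh
      + MetaStorm.kappa₂ β σh * Real.log (1 + σ ^ 2 * ((n + 1 : ℕ) : ℝ)) := by
    have h1 : 0 ≤ MetaStorm.kappa₂ β σh * Real.log (MetaStorm.kappa₂ β σh) :=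
      mul_nonneg (by linarith) (Real.log_nonneg hk)
    rw [MetaStorm.kappa₁]
    positivity
  generalize MetaStorm.kappa₁ (MetaStorm.objective 𝒟 f x₁ - ⨅ x, MetaStorm.objective 𝒟 f x) σ β σh
    + MetaStorm.kappa₂ β σh * Real.log (1 + σ ^ 2 * ((n + 1 : ℕ) : ℝ)) = κ at *
  have hT0 : (0 : ℝ) < ((n + 1 : ℕ) : ℝ) := by positivity
  have hUE := MetaStorm.integral_pathU_cube_le (x₁ := x₁) h hR n
  -- With `q⁶ = σ² T`, the rate is `(1 + q) / √T`, and `U = 2 (1 + q)²` satisfies `𝔼 u³ ≤ U³`.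
  obtain ⟨q, hq⟩ : ∃ q : ℝ, q = σ ^ (1 / 3 : ℝ) * ((n + 1 : ℕ) : ℝ) ^ (1 / 6 : ℝ) := ⟨_, rfl⟩
  have hq0 : 0 ≤ q := by rw [hq]; positivity
  have hq6 : q ^ 6 = σ ^ 2 * ((n + 1 : ℕ) : ℝ) := by
    rw [hq, mul_pow, ← Real.rpow_natCast, ← Real.rpow_mul hσ, ← Real.rpow_natCast,
      ← Real.rpow_mul hT0.le]
    norm_num
  have hU : ∫ ω, MetaStorm.pathU f x₁ (fun i => ξ i ω) n ^ 3 ∂P ≤ (2 * (1 + q) ^ 2) ^ 3 := by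
    refine hUE.trans ?_
    have h1 : 1 + 4 * σ ^ 2 * n ≤ 1 + 4 * q ^ 6 := by
      rw [hq6]; push_cast; nlinarith [sq_nonneg σ]
    have h2 : 1 + q ^ 6 ≤ (1 + q) ^ 6 := by
      have : 0 ≤ 6 * q + 15 * q ^ 2 + 20 * q ^ 3 + 15 * q ^ 4 + 6 * q ^ 5 := by positivity
      linarith
    have h3 : (2 * (1 + q) ^ 2) ^ 3 = 8 * (1 + q) ^ 6 := by ring
    have h4 : 0 ≤ q ^ 6 := by positivity
    rw [h3]; linarith
  have hrate : 1 / ((n + 1 : ℕ) : ℝ) ^ (1 / 2 : ℝ) + σ ^ (1 / 3 : ℝ) / ((n + 1 : ℕ) : ℝ) ^ (1 / 3 : ℝ)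
      = (1 + q) / ((n + 1 : ℕ) : ℝ) ^ (1 / 2 : ℝ) := by
    have h1 : ((n + 1 : ℕ) : ℝ) ^ (1 / 2 : ℝ)
        = ((n + 1 : ℕ) : ℝ) ^ (1 / 6 : ℝ) * ((n + 1 : ℕ) : ℝ) ^ (1 / 3 : ℝ) := by
      rw [← Real.rpow_add hT0]; norm_num
    rw [hq, add_div, h1]
    congr 1
    field_simp
  rw [hrate]
  -- For `U = 2 (1 + q)²` and `V = 40 (10 ^ 7)² κ` the threshold condition is an equality: the
  -- factor `2` in `C` squares to the `4` in `2 U V² = 4 (1 + q)² V²`.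
  have hbad := MetaStorm.measure_output_gt_le_of_le (x₁ := x₁) h hR
    (R := 2 * (40 * (10 ^ 7) ^ 2) * (κ / δ ^ (7 / 6 : ℝ))
      * ((1 + q) / ((n + 1 : ℕ) : ℝ) ^ (1 / 2 : ℝ))) hδ (by positivity)
    (by positivity) (by positivity) hU hV (by
      have h1 : (((n + 1 : ℕ) : ℝ) ^ (1 / 2 : ℝ)) ^ 2 = ((n + 1 : ℕ) : ℝ) := by
        rw [← Real.rpow_natCast, ← Real.rpow_mul hT0.le]; norm_num
      have h2 : (δ ^ (7 / 6 : ℝ)) ^ 2 = δ ^ (7 / 3 : ℝ) := by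
        rw [← Real.rpow_natCast, ← Real.rpow_mul hδ.le]; norm_num
      have ha : 0 < δ ^ (7 / 6 : ℝ) := by positivity
      have hb : 0 < ((n + 1 : ℕ) : ℝ) ^ (1 / 2 : ℝ) := by positivity
      rw [← h2]
      nth_rewrite 1 [← h1]
      generalize δ ^ (7 / 6 : ℝ) = a at *
      generalize ((n + 1 : ℕ) : ℝ) ^ (1 / 2 : ℝ) = b at *
      refine le_of_eq ?_
      field_simp)
  have hcover : (Set.univ : Set Ω) ⊆ _ ∪ _ := fun ω _ => le_or_gt
    ‖gradient (MetaStorm.objective 𝒟 f) (MetaStorm.output f MetaStorm.stdParams x₁ ξ τ ω)‖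
    (2 * (40 * (10 ^ 7) ^ 2) * (κ / δ ^ (7 / 6 : ℝ))
      * ((1 + q) / ((n + 1 : ℕ) : ℝ) ^ (1 / 2 : ℝ)))
  have hone := (measure_mono (μ := P) hcover).trans (measure_union_le _ _)
  rw [measure_univ] at hone
  rw [ENNReal.ofReal_sub _ hδ.le, ENNReal.ofReal_one]
  exact tsub_le_iff_right.2 (hone.trans (add_le_add le_rfl hbad))
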